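/- Let $t\ge 1$ be a squarefree integer, $E=\operatorname{diag}(1,t)$, $\Lambda=\begin{pmatrix}0&E\\-E&0\end{pmatrix}$, and let $\alpha(x,y)=x\Lambda\,{}^t y$ be the associated alternating form on row vectors in $\mathbb{Q}^4$. Put $\mathbb{L}=\mathbb{Z}^4$, let $\mathbb{L}^\vee=\mathbb{Z}\oplus\frac1t\mathbb{Z}\oplus\mathbb{Z}\oplus\frac1t\mathbb{Z}$ be its dual lattice with respect to $\alpha$, and let $$\tilde\Gamma_{1,t}=\{g\in \mathrm{GL}(4,\mathbb{Z}) \mid g\Lambda\,{}^t g=\Lambda,\ vg\equiv v \bmod \mathbb{L}\text{ for all }v\in\mathbb{L}^\vee\},$$ acting on row vectors $\mathbb{Q}^4$ by right multiplication. The Tits building $\mathcal{T}(\tilde\Gamma_{1,t})$ is the graph whose vertices are the $\tilde\Gamma_{1,t}$-orbits of nonzero $\Lambda$-isotropic subspaces of $\mathbb{Q}^4$; two distinct vertices, the orbits of $U_1$ and $U_2$, are joined iff $U_1\gamma\subseteq U_2$ or $U_2\subseteq U_1\gamma$ for some $\gamma\in\tilde\Gamma_{1,t}$. Orbits of lines (planes)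 are called line vertices (plane vertices). For $n\ge1$ let $\mathcal{N}(n)$ be the set of $(a,b)\in(\mathbb{Z}/n)^2$ with $\lambda(a,b)\ne0$ for all $0\neq\lambda\in\mathbb{Z}/n$, that is, with $\gcd(n,a,b)=1$; let $\mathcal{M}(n)=\mathcal{N}(n)/\{\pm1\}$ and $\mathcal{O}(n)=\mathcal{N}(n)/(\mathbb{Z}/n)^\times$. Let $\nu(1)=1$, $\nu(2)=3$ and $\nu(n)=\frac12n^2\prod_{q\mid n}(1-q^{-2})$ for $n\ge3$; let $\tilde\nu(1)=1$, $\tilde\nu(2)=3$ and $\tilde\nu(n)=\frac{1}{\phi(n)}n^2\prod_{q\mid n}(1-q^{-2})$ for $n\ge3$, where $q$ runs over primes and $\phi$ is Euler's function; and let $\psi(t)=\sum_{r\mid t}\nu(r)$. **Theorem.** Every vertex of $\mathcal{T}(\tilde\Gamma_{1,t})$ is either a line vertex or a plane vertex, and not both. 1. There are exactly $\psi(t)$ line vertices. They are represented, without repetition, by $\ell_0=\mathbb{Q}(1,0,0,0)$ and the lines $\ell_{r,(v_2,v_4)}=\mathbb{Q}(r,v_2,0,v_4)$, where $r$ runs through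 the divisors $\ne1$ of $t$ and $(v_2,v_4)$ through the classes in $\mathcal{M}(r)$; the orbit of $\ell_{r,(v_2,v_4)}$ does not depend on the integers $v_2,v_4$ chosen to represent the class. 2. There are exactly $\tilde\nu(t)$ plane vertices. They are represented, without repetition, by the planes $h_{[w_2,w_4]}$ spanned by $(1,0,0,0)$ and $(0,w_2,0,w_4)$, where $(w_2,w_4)$ runs through the classes in $\mathcal{O}(t)$; the orbit of $h_{[w_2,w_4]}$ does not depend on the integers $w_2,w_4$, not both zero, chosen to represent the class. 3. Every plane vertex is joined to $\ell_0$. The vertices $\ell_{r,(v_2,v_4)}$ and $h_{[w_2,w_4]}$ are joined if and only if $(v_2,v_4)$ and $(w_2,w_4)$ represent the same class in $\mathcal{O}(r)$. Every edge joins a line vertex to a plane vertex. -/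

import Mathlib

noncomputable section

namespace ParaTits

open Matrix

/-! ## The symplectic form, the lattice and the groups -/

/-- The matrix `Λ = (0, E; -E, 0)` with `E = diag(1, t)`. -/
def Lam (R : Type*) [CommRing R] (t : ℕ) : Matrix (Fin 4) (Fin 4) R :=
  !![0, 0, 1, 0;
     0, 0, 0, (t : R);
     -1, 0, 0, 0;
     0, -(t : R), 0, 0]

/-- The alternating form `α(x, y) = x Λ yᵗ` on row vectors in `ℚ⁴`. -/
def form (t : ℕ) (x y : Fin 4 → ℚ) : ℚ := x ⬝ᵥ (Lam ℚ t *ᵥ y)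

theorem form_eq (t : ℕ) (x y : Fin 4 → ℚ) :
    form t x y = x 0 * y 2 + t * (x 1 * y 3) - x 2 * y 0 - t * (x 3 * y 1) := by
  simp [form, Lam, dotProduct, mulVec, Fin.sum_univ_four]
  ring

/-- The rational matrix of an element of `GL(4, ℤ)`. -/
def ratMat (g : GL (Fin 4) ℤ) : Matrix (Fin 4) (Fin 4) ℚ :=
  (g : Matrix (Fin 4) (Fin 4) ℤ).map (Int.castRingHom ℚ)

theorem ratMat_one : ratMat 1 = 1 := by
  simp [ratMat]

theorem ratMat_mul (g h : GL (Fin 4) ℤ) : ratMat (g * h) = ratMat g * ratMat h := by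
  simp only [ratMat, Units.val_mul, Matrix.map_mul]

/-- The lattice `𝕃 = ℤ⁴` inside `ℚ⁴`. -/
def lattice : AddSubgroup (Fin 4 → ℚ) where
  carrier := {x | ∀ i, ∃ m : ℤ, x i = m}
  zero_mem' := fun _ => ⟨0, by simp⟩
  add_mem' := by
    intro x y hx hy i
    obtain ⟨m, hm⟩ := hx i
    obtain ⟨n, hn⟩ := hy i
    exact ⟨m + n, by simp [hm, hn]⟩
  neg_mem' := by
    intro x hx i
    obtain ⟨m, hm⟩ := hx i
    exact ⟨-m, by simp [hm]⟩

/-- The dual lattice `𝕃^∨` of `𝕃` with respect to `α`. (For `t > 0` the form is nondegenerate and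
the dual lattice in `𝕃 ⊗ ℝ` lies in `𝕃 ⊗ ℚ`.) -/
def dualLattice (t : ℕ) : Set (Fin 4 → ℚ) :=
  {y | ∀ x ∈ lattice, ∃ m : ℤ, form t x y = m}

theorem lattice_vecMul (g : GL (Fin 4) ℤ) {x : Fin 4 → ℚ} (hx : x ∈ lattice) :
    x ᵥ* ratMat g ∈ lattice := by
  intro i
  choose m hm using hx
  refine ⟨∑ j, m j * (g : Matrix (Fin 4) (Fin 4) ℤ) j i, ?_⟩
  simp [vecMul, dotProduct, ratMat, hm]

/-- The group `Γ̃°_{1,t} = Sp(Λ, ℤ)`. -/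
def GammaCirc (t : ℕ) : Subgroup (GL (Fin 4) ℤ) where
  carrier := {g | (g : Matrix (Fin 4) (Fin 4) ℤ) * Lam ℤ t *
    (g : Matrix (Fin 4) (Fin 4) ℤ)ᵀ = Lam ℤ t}
  one_mem' := by simp
  mul_mem' := by
    intro g h hg hh
    simp only [Set.mem_ofPred_eq] at hg hh ⊢
    calc _ = (g : Matrix (Fin 4) (Fin 4) ℤ) * ((h : Matrix (Fin 4) (Fin 4) ℤ) * Lam ℤ t *
          (h : Matrix (Fin 4) (Fin 4) ℤ)ᵀ) * (g : Matrix (Fin 4) (Fin 4) ℤ)ᵀ := by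
            simp only [Units.val_mul, transpose_mul, Matrix.mul_assoc]
      _ = Lam ℤ t := by rw [hh, hg]
  inv_mem' := by
    intro g hg
    simp only [Set.mem_ofPred_eq] at hg ⊢
    have h1 : ((g⁻¹ : GL (Fin 4) ℤ) : Matrix (Fin 4) (Fin 4) ℤ) *
        (g : Matrix (Fin 4) (Fin 4) ℤ) = 1 := by
      rw [← Units.val_mul, inv_mul_cancel, Units.val_one]
    have h2 : (g : Matrix (Fin 4) (Fin 4) ℤ)ᵀ *
        ((g⁻¹ : GL (Fin 4) ℤ) : Matrix (Fin 4) (Fin 4) ℤ)ᵀ = 1 := by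
      rw [← transpose_mul, h1, transpose_one]
    calc _ = ((g⁻¹ : GL (Fin 4) ℤ) : Matrix (Fin 4) (Fin 4) ℤ) *
          ((g : Matrix (Fin 4) (Fin 4) ℤ) * Lam ℤ t * (g : Matrix (Fin 4) (Fin 4) ℤ)ᵀ) *
          ((g⁻¹ : GL (Fin 4) ℤ) : Matrix (Fin 4) (Fin 4) ℤ)ᵀ := by rw [hg]
      _ = (((g⁻¹ : GL (Fin 4) ℤ) : Matrix (Fin 4) (Fin 4) ℤ) *
          (g : Matrix (Fin 4) (Fin 4) ℤ)) * Lam ℤ t * ((g : Matrix (Fin 4) (Fin 4) ℤ)ᵀ *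
          ((g⁻¹ : GL (Fin 4) ℤ) : Matrix (Fin 4) (Fin 4) ℤ)ᵀ) := by
            simp only [Matrix.mul_assoc]
      _ = Lam ℤ t := by rw [h1, h2, Matrix.one_mul, Matrix.mul_one]

/-- The group `Γ̃_{1,t}`: all `g ∈ Γ̃°_{1,t}` with `v g ≡ v mod 𝕃` for all `v ∈ 𝕃^∨`. -/
def Gamma (t : ℕ) : Subgroup (GL (Fin 4) ℤ) where
  carrier := {g | g ∈ GammaCirc t ∧ ∀ v ∈ dualLattice t, v ᵥ* ratMat g - v ∈ lattice}
  one_mem' := by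
    refine ⟨one_mem _, fun v _ => ?_⟩
    rw [ratMat_one, vecMul_one, sub_self]
    exact zero_mem _
  mul_mem' := by
    rintro g h ⟨hg, hg'⟩ ⟨hh, hh'⟩
    refine ⟨mul_mem hg hh, fun v hv => ?_⟩
    have := add_mem (lattice_vecMul h (hg' v hv)) (hh' v hv)
    rw [sub_vecMul, vecMul_vecMul, ← ratMat_mul, sub_add_sub_cancel] at this
    exact this
  inv_mem' := by
    rintro g ⟨hg, hg'⟩
    refine ⟨inv_mem hg, fun v hv => ?_⟩
    have := neg_mem (lattice_vecMul g⁻¹ (hg' v hv))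
    rw [sub_vecMul, vecMul_vecMul, ← ratMat_mul, mul_inv_cancel, ratMat_one, vecMul_one,
      neg_sub] at this
    exact this

/-! ## The Tits building -/

/-- The subspace `U · g` for a subspace `U` of the space of row vectors `ℚ⁴`. -/
def act (U : Submodule ℚ (Fin 4 → ℚ)) (g : GL (Fin 4) ℤ) : Submodule ℚ (Fin 4 → ℚ) :=
  U.map (ratMat g).vecMulLinear

theorem act_one (U : Submodule ℚ (Fin 4 → ℚ)) : act U 1 = U := by
  ext x
  simp [act, ratMat_one]

theorem act_mul (U : Submodule ℚ (Fin 4 → ℚ)) (g h : GL (Fin 4) ℤ) :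
    act U (g * h) = act (act U g) h := by
  ext x
  simp [act, ratMat_mul, vecMul_vecMul]

theorem act_mono {U V : Submodule ℚ (Fin 4 → ℚ)} (h : U ≤ V) (g : GL (Fin 4) ℤ) :
    act U g ≤ act V g := Submodule.map_mono h

/-- A subspace of `ℚ⁴` that is isotropic for `Λ`. -/
def IsIsotropic (t : ℕ) (U : Submodule ℚ (Fin 4 → ℚ)) : Prop :=
  ∀ x ∈ U, ∀ y ∈ U, form t x y = 0

/-- The nontrivial (that is, nonzero) `Λ`-isotropic subspaces of `ℚ⁴`. -/
abbrev IsoSubspace (t : ℕ) : Type :=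
  {U : Submodule ℚ (Fin 4 → ℚ) // U ≠ ⊥ ∧ IsIsotropic t U}

/-- `Γ̃_{1,t}`-equivalence of isotropic subspaces. -/
def isoSetoid (t : ℕ) : Setoid (IsoSubspace t) where
  r U V := ∃ g ∈ Gamma t, act U.1 g = V.1
  iseqv :=
    { refl := fun U => ⟨1, one_mem _, act_one _⟩
      symm := by
        rintro U V ⟨g, hg, h⟩
        exact ⟨g⁻¹, inv_mem hg, by rw [← h, ← act_mul, mul_inv_cancel, act_one]⟩
      trans := by
        rintro U V W ⟨g, hg, h⟩ ⟨g', hg', h'⟩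
        exact ⟨g * g', mul_mem hg hg', by rw [act_mul, h, h']⟩ }

/-- The vertices of the Tits building: the `Γ̃_{1,t}`-orbits of nontrivial isotropic subspaces. -/
def Vertex (t : ℕ) : Type := Quotient (isoSetoid t)

/-- The vertex `e(U · Γ̃_{1,t})`. -/
def vertexOf {t : ℕ} (U : IsoSubspace t) : Vertex t := Quotient.mk (isoSetoid t) U

/-- The Tits building of `Γ̃_{1,t}`: two distinct vertices `e(U₁ Γ̃_{1,t})` and `e(U₂ Γ̃_{1,t})` are
joined iff `U₁ γ ⊆ U₂` or `U₂ ⊆ U₁ γ` for some `γ ∈ Γ̃_{1,t}`. -/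
def building (t : ℕ) : SimpleGraph (Vertex t) where
  Adj x y := x ≠ y ∧ ∃ U₁ U₂ : IsoSubspace t, vertexOf U₁ = x ∧ vertexOf U₂ = y ∧
    ∃ g ∈ Gamma t, act U₁.1 g ≤ U₂.1 ∨ U₂.1 ≤ act U₁.1 g
  symm := by
    constructor
    rintro x y ⟨hne, U₁, U₂, h₁, h₂, g, hg, h⟩
    refine ⟨hne.symm, U₂, U₁, h₂, h₁, g⁻¹, inv_mem hg, ?_⟩
    have key : act (act U₁.1 g) g⁻¹ = U₁.1 := by rw [← act_mul, mul_inv_cancel, act_one]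
    rcases h with h | h
    · right
      have := act_mono h g⁻¹
      rwa [key] at this
    · left
      have := act_mono h g⁻¹
      rwa [key] at this
  loopless := ⟨fun _ h => h.1 rfl⟩

/-- A vertex given by an orbit of lines. -/
def IsLineVertex {t : ℕ} (x : Vertex t) : Prop :=
  ∃ U : IsoSubspace t, vertexOf U = x ∧ Module.finrank ℚ U.1 = 1

/-- A vertex given by an orbit of isotropic planes. -/
def IsPlaneVertex {t : ℕ} (x : Vertex t) : Prop :=
  ∃ U : IsoSubspace t, vertexOf U = x ∧ Module.finrank ℚ U.1 = 2

/-! ## Lines and planes used as representatives -/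

theorem isIsotropic_span_pair (t : ℕ) (v w : Fin 4 → ℚ) (h : form t v w = 0) :
    IsIsotropic t (Submodule.span ℚ {v, w}) := by
  intro x hx y hy
  obtain ⟨a, b, rfl⟩ := Submodule.mem_span_pair.1 hx
  obtain ⟨c, d, rfl⟩ := Submodule.mem_span_pair.1 hy
  rw [form_eq] at h ⊢
  simp only [Pi.add_apply, Pi.smul_apply, smul_eq_mul]
  linear_combination (a * d - b * c) * h

theorem isIsotropic_span_singleton (t : ℕ) (v : Fin 4 → ℚ) :
    IsIsotropic t (Submodule.span ℚ {v}) := by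
  have h := isIsotropic_span_pair t v v (by rw [form_eq]; ring)
  rwa [Set.pair_eq_singleton] at h

/-- The vector `v₀ = (1, 0, 0, 0)`. -/
def v0 : Fin 4 → ℚ := ![1, 0, 0, 0]

/-- The vector `v_{(a,b)} = (0, a, 0, b)`. -/
def vec (a b : ℤ) : Fin 4 → ℚ := ![0, a, 0, b]

theorem v0_ne_zero : v0 ≠ 0 := fun h => by simpa [v0] using congrFun h 0

/-- The line `ℓ₀ = ℚ v₀`. -/
def line0 (t : ℕ) : IsoSubspace t :=
  ⟨Submodule.span ℚ {v0}, by simpa using v0_ne_zero, isIsotropic_span_singleton t _⟩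

/-- The line `ℚ (r, a, 0, b)`, for `r ≠ 0`. -/
def line (t : ℕ) {r : ℕ} (hr : r ≠ 0) (a b : ℤ) : IsoSubspace t :=
  ⟨Submodule.span ℚ {![(r : ℚ), a, 0, b]},
    by
      rw [Ne, Submodule.span_singleton_eq_bot]
      intro h
      exact hr (by simpa using congrFun h 0),
    isIsotropic_span_singleton t _⟩

/-- The subspace `v₀ ∧ v_{(a,b)}` spanned by `v₀` and `v_{(a,b)}` (a plane if `(a,b) ≠ (0,0)`). -/
def plane (t : ℕ) (a b : ℤ) : IsoSubspace t :=
  ⟨Submodule.span ℚ {v0, vec a b},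
    by
      intro h
      have : v0 ∈ Submodule.span ℚ {v0, vec a b} := Submodule.subset_span (by simp)
      rw [h, Submodule.mem_bot] at this
      exact v0_ne_zero this,
    isIsotropic_span_pair t _ _ (by rw [form_eq]; simp [v0, vec])⟩

/-! ## The index sets `𝒩(n)`, `ℳ(n)`, `𝒪(n)` -/

/-- `𝒩(n)`: the nontorsion elements of `(ℤ/n)²`. -/
def NN (n : ℕ) : Set (ZMod n × ZMod n) := {p | ∀ c : ZMod n, c ≠ 0 → c • p ≠ 0}

/-- The residue class of an integer pair modulo `n`. -/
def residue (n : ℕ) (a b : ℤ) : ZMod n × ZMod n := ((a : ZMod n), (b : ZMod n))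

/-- Equality up to sign on `𝒩(n)`. -/
def signSetoid (n : ℕ) : Setoid (NN n) where
  r p q := q.1 = p.1 ∨ q.1 = -p.1
  iseqv :=
    { refl := fun _ => Or.inl rfl
      symm := by
        rintro p q (h | h)
        · exact Or.inl h.symm
        · exact Or.inr (by rw [h, neg_neg])
      trans := by
        rintro p q s (h | h) (h' | h') <;> rw [h', h]
        · exact Or.inl rfl
        · exact Or.inr rfl
        · exact Or.inr rfl
        · exact Or.inl (neg_neg _) }

/-- `ℳ(n) = 𝒩(n) / ±1`. -/
def MM (n : ℕ) : Type := Quotient (signSetoid n)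

/-- The class of an element of `𝒩(n)` in `ℳ(n)`. -/
def MM.mk {n : ℕ} (p : NN n) : MM n := Quotient.mk (signSetoid n) p

/-- The orbit relation of `(ℤ/n)ˣ` on `𝒩(n)`. -/
def unitSetoid (n : ℕ) : Setoid (NN n) where
  r p q := ∃ u : (ZMod n)ˣ, (u : ZMod n) • p.1 = q.1
  iseqv :=
    { refl := fun _ => ⟨1, by simp⟩
      symm := by
        rintro p q ⟨u, h⟩
        exact ⟨u⁻¹, by rw [← h, smul_smul, Units.inv_mul, one_smul]⟩
      trans := by
        rintro p q s ⟨u, h⟩ ⟨u', h'⟩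
        exact ⟨u' * u, by rw [Units.val_mul, ← smul_smul, h, h']⟩ }

/-- `𝒪(n) = 𝒩(n) / (ℤ/n)ˣ`. -/
def OO (n : ℕ) : Type := Quotient (unitSetoid n)

/-- The class of an element of `𝒩(n)` in `𝒪(n)`. -/
def OO.mk {n : ℕ} (p : NN n) : OO n := Quotient.mk (unitSetoid n) p

/-- The canonical map `ℳ(n) → 𝒪(n)`. -/
def MM.toOO {n : ℕ} : MM n → OO n :=
  Quotient.map' (s₁ := signSetoid n) (s₂ := unitSetoid n) id (by
    rintro p q (h | h)
    · exact ⟨1, by simp [h]⟩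
    · exact ⟨-1, by simp [h]⟩)

/-- Reduction modulo a divisor `r` of `t` sends `𝒩(t)` to `𝒩(r)`. -/
theorem NN_reduce {r t : ℕ} (ht : t ≠ 0) (h : r ∣ t) {p : ZMod t × ZMod t} (hp : p ∈ NN t) :
    (ZMod.castHom h (ZMod r) p.1, ZMod.castHom h (ZMod r) p.2) ∈ NN r := by
  obtain ⟨k, rfl⟩ := h
  obtain ⟨a, b⟩ := p
  obtain ⟨a, rfl⟩ := ZMod.intCast_surjective a
  obtain ⟨b, rfl⟩ := ZMod.intCast_surjective b
  intro c hc h0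
  obtain ⟨c, rfl⟩ := ZMod.intCast_surjective c
  have hk : (k : ℤ) ≠ 0 := by
    rintro h
    exact ht (by simp_all)
  have aux : ∀ m : ℤ, (((c : ℤ) : ZMod r) * (m : ZMod r) = 0) →
      (((c * k : ℤ) : ZMod (r * k)) * (m : ZMod (r * k)) = 0) := by
    intro m hm
    rw [← Int.cast_mul, ZMod.intCast_zmod_eq_zero_iff_dvd] at hm ⊢
    obtain ⟨d, hd⟩ := hm
    exact ⟨d, by push_cast; linear_combination (k : ℤ) * hd⟩
  refine hp ((c * k : ℤ) : ZMod (r * k)) ?_ ?_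
  · intro h1
    apply hc
    rw [ZMod.intCast_zmod_eq_zero_iff_dvd] at h1 ⊢
    push_cast at h1
    exact Int.dvd_of_mul_dvd_mul_right hk h1
  · have h1 := congrArg Prod.fst h0
    have h2 := congrArg Prod.snd h0
    simp only [Prod.smul_mk, smul_eq_mul, map_intCast, Prod.fst_zero, Prod.snd_zero] at h1 h2
    simp only [Prod.smul_mk, smul_eq_mul]
    rw [aux a h1, aux b h2]
    rfl

/-- The reduction map `𝒪(t) → 𝒪(r)` for a divisor `r` of `t`. -/
def OO.reduce {r t : ℕ} (ht : t ≠ 0) (h : r ∣ t) : OO t → OO r :=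
  Quotient.map' (s₁ := unitSetoid t) (s₂ := unitSetoid r)
    (fun p => ⟨(ZMod.castHom h (ZMod r) p.1.1, ZMod.castHom h (ZMod r) p.1.2),
      NN_reduce ht h p.2⟩) (by
    rintro p q ⟨u, hu⟩
    refine ⟨Units.map (ZMod.castHom h (ZMod r)).toMonoidHom u, ?_⟩
    have h1 : (u : ZMod t) * p.1.1 = q.1.1 := congrArg Prod.fst hu
    have h2 : (u : ZMod t) * p.1.2 = q.1.2 := congrArg Prod.snd hu
    refine Prod.ext ?_ ?_
    · exact (map_mul (ZMod.castHom h (ZMod r)) _ _).symm.trans (congrArg _ h1)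
    · exact (map_mul (ZMod.castHom h (ZMod r)) _ _).symm.trans (congrArg _ h2))

/-- The index set of the line vertices other than `ℓ₀`: pairs of a divisor `r ≠ 1` of `t` and an
element of `ℳ(r)`. -/
abbrev LineIndex (t : ℕ) : Type := Σ r : {r : ℕ // r ∣ t ∧ r ≠ 1}, MM r.1

/-! ## The arithmetic functions -/

/-- `ν(n)`, for `n ≥ 1`. -/
def nu (n : ℕ) : ℚ :=
  if n = 1 then 1 else if n = 2 then 3
  else 1 / 2 * (n : ℚ) ^ 2 * ∏ q ∈ n.primeFactors, (1 - 1 / (q : ℚ) ^ 2)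

/-- `ψ(t)`, the sum of `ν(r)` over the divisors `r` of `t`. -/
def psi (t : ℕ) : ℚ := ∑ r ∈ t.divisors, nu r

/-- `ν̃(n)`, for `n ≥ 1`. -/
def nuTilde (n : ℕ) : ℚ :=
  if n = 1 then 1 else if n = 2 then 3
  else 1 / (n.totient : ℚ) * (n : ℚ) ^ 2 * ∏ q ∈ n.primeFactors, (1 - 1 / (q : ℚ) ^ 2)

end ParaTits

end

open ParaTits

/-!
The vertices are classified by explicit invariants of integer vectors. An element of `Γ̃_{1,t}` is
an integral symplectic matrix whose second and fourth rows are those of the identity modulo `t`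
(`dvd_row_of_mem_Gamma`, `mem_Gamma_of_dvd`). Hence `r = gcd(t, x₀, x₂)` and the residues of
`x₁, x₃` modulo `r` are invariants of an integer vector `x` (`VecEquiv.gcd_eq`, `VecEquiv.dvd`).
Conversely, for primitive `x` they are complete invariants: `SL(2, ℤ)` acting on the first and third
coordinates together with Eichler transformations moves `x` to `(r, a, 0, b)` for all `a ≡ x₁`,
`b ≡ x₃` modulo `r` (`vecEquiv_normalForm`). A rational line has a primitive generator that is
unique up to sign, whence the classification of line vertices by the divisors `r` of `t` and the
elements of `ℳ(r)` (`lineVertex_injective`, `range_lineVertex`); the divisor `r = 1` gives `ℓ₀`.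

For an isotropic plane the point is to find in it a primitive vector with `gcd(t, x₀, x₂) = 1`
(`exists_gcd_eq_one`). If all integer vectors `x`, `y` of the plane had `p ∣ x₀, x₂, y₀, y₂` for a
prime `p ∣ t`, isotropy would give `p² ∣ t (x₁ y₃ - x₃ y₁)`, hence `p ∣ x₁ y₃ - x₃ y₁` because `t`
is squarefree, and the plane would contain a primitive vector divisible by `p` (`exists_not_dvd`).
A primitive vector with `gcd(t, x₀, x₂) = 1` can be moved to `v₀`, and then the plane is spanned by
`v₀` and some `(0, a, 0, b)` with `a`, `b` coprime (`exists_act_eq_plane`).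
The remaining ambiguity is the choice of the primitive vector in the plane that is moved to `v₀`;
it multiplies `(a, b)` by a unit modulo `t` (`exists_vertexOf_plane_eq`), and all units occur, while
the principal congruence subgroup of `SL(2, ℤ)` identifies coprime pairs with equal residues
(`exists_mem_Gamma_of_residue_eq`). So plane vertices correspond to `𝒪(t)`.

An edge is a containment of a translate of a line in a plane. The integer vectors of the plane of
`(a, b)` are the `(m, n a, 0, n b)`, so the invariants of such vectors decide which lines occur
(`adj_lineVertex_planeVertex_iff`). The numbers of vertices follow from the Chinese remainder
theorem for `|𝒩(n)|` and from the actions on `𝒩(n)` of the units, which is free, and of `±1`, which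
is free for `n ≥ 3` and trivial for `n ≤ 2`.
-/

namespace ParaTits

open Matrix

/-! ### The group `Γ̃_{1,t}` and its action on integer vectors -/

/-- The rational vector with the coordinates of an integer vector. -/
def toRat (x : Fin 4 → ℤ) : Fin 4 → ℚ := fun i => (x i : ℚ)

theorem toRat_vecMul (x : Fin 4 → ℤ) (g : GL (Fin 4) ℤ) :
    toRat (x ᵥ* (g : Matrix (Fin 4) (Fin 4) ℤ)) = toRat x ᵥ* ratMat g := by
  ext i
  simp [toRat, vecMul, dotProduct, ratMat]

theorem mem_lattice {x : Fin 4 → ℚ} : x ∈ lattice ↔ ∃ y : Fin 4 → ℤ, x = toRat y := by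
  constructor
  · intro h
    choose m hm using h
    exact ⟨m, funext hm⟩
  · rintro ⟨y, rfl⟩ i
    exact ⟨y i, rfl⟩

/-- Pairing with the standard basis vectors bounds the denominators of a vector of `𝕃^∨`. -/
theorem mem_dualLattice {t : ℕ} {v : Fin 4 → ℚ} (hv : v ∈ dualLattice t) :
    (∃ m : ℤ, v 0 = m) ∧ (∃ m : ℤ, t * v 1 = m) ∧ (∃ m : ℤ, v 2 = m) ∧
      ∃ m : ℤ, t * v 3 = m := by
  have key : ∀ x : Fin 4 → ℤ, ∃ m : ℤ, form t (toRat x) v = m :=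
    fun x => hv _ (mem_lattice.2 ⟨x, rfl⟩)
  obtain ⟨a, ha⟩ := key ![0, 0, -1, 0]
  obtain ⟨b, hb⟩ := key ![0, 0, 0, -1]
  obtain ⟨c, hc⟩ := key ![1, 0, 0, 0]
  obtain ⟨d, hd⟩ := key ![0, 1, 0, 0]
  simp [form_eq, toRat] at ha hb hc hd
  exact ⟨⟨a, ha⟩, ⟨b, hb⟩, ⟨c, hc⟩, ⟨d, hd⟩⟩

theorem single_mem_dualLattice {t : ℕ} (ht : t ≠ 0) {i : Fin 4} (hi : i = 1 ∨ i = 3) :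
    Pi.single i (1 / (t : ℚ)) ∈ dualLattice t := by
  have ht' : (t : ℚ) ≠ 0 := by exact_mod_cast ht
  intro x hx
  obtain ⟨y, rfl⟩ := mem_lattice.1 hx
  rcases hi with rfl | rfl
  · exact ⟨-y 3, by simp [form_eq, toRat]; field_simp⟩
  · exact ⟨y 1, by simp [form_eq, toRat]; field_simp⟩

/-- The congruence satisfied by the elements of `Γ̃_{1,t}`: the rows that correspond to the
generators of `𝕃^∨` outside `𝕃` are those of the identity modulo `t`. -/
theorem dvd_row_of_mem_Gamma {t : ℕ} (ht : t ≠ 0) {g : GL (Fin 4) ℤ} (hg : g ∈ Gamma t)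
    {i : Fin 4} (hi : i = 1 ∨ i = 3) (j : Fin 4) :
    (t : ℤ) ∣ (g : Matrix (Fin 4) (Fin 4) ℤ) i j - (1 : Matrix (Fin 4) (Fin 4) ℤ) i j := by
  have ht' : (t : ℚ) ≠ 0 := by exact_mod_cast ht
  obtain ⟨m, hm⟩ := hg.2 _ (single_mem_dualLattice ht hi) j
  refine ⟨m, ?_⟩
  simp only [Pi.sub_apply, single_vecMul, Pi.smul_apply, ratMat, Matrix.row, Matrix.map_apply,
    smul_eq_mul, eq_intCast] at hm
  have h1 : (Pi.single i (1 / (t : ℚ)) : Fin 4 → ℚ) j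
      = 1 / t * ((1 : Matrix (Fin 4) (Fin 4) ℤ) i j : ℚ) := by
    by_cases hij : i = j
    · subst hij; simp
    · simp [hij, Ne.symm hij]
  rw [h1] at hm
  field_simp at hm
  exact_mod_cast hm

theorem mem_Gamma_of_dvd {t : ℕ} {g : GL (Fin 4) ℤ} (hg : g ∈ GammaCirc t)
    (h1 : ∀ j, (t : ℤ) ∣
      (g : Matrix (Fin 4) (Fin 4) ℤ) 1 j - (1 : Matrix (Fin 4) (Fin 4) ℤ) 1 j)
    (h3 : ∀ j, (t : ℤ) ∣
      (g : Matrix (Fin 4) (Fin 4) ℤ) 3 j - (1 : Matrix (Fin 4) (Fin 4) ℤ) 3 j) :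
    g ∈ Gamma t := by
  refine ⟨hg, fun v hv j => ?_⟩
  obtain ⟨⟨a, ha⟩, ⟨b, hb⟩, ⟨c, hc⟩, ⟨d, hd⟩⟩ := mem_dualLattice hv
  obtain ⟨k, hk⟩ := h1 j
  obtain ⟨l, hl⟩ := h3 j
  refine ⟨a * ((g : Matrix (Fin 4) (Fin 4) ℤ) 0 j - (1 : Matrix (Fin 4) (Fin 4) ℤ) 0 j)
    + b * k + c * ((g : Matrix (Fin 4) (Fin 4) ℤ) 2 j - (1 : Matrix (Fin 4) (Fin 4) ℤ) 2 j)
    + d * l, ?_⟩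
  have hk' := congrArg (Int.cast : ℤ → ℚ) hk
  have hl' := congrArg (Int.cast : ℤ → ℚ) hl
  push_cast at hk' hl'
  have hvj : v j = ∑ i, v i * ((1 : Matrix (Fin 4) (Fin 4) ℤ) i j : ℚ) := by
    simp [Matrix.one_apply]
  push_cast
  rw [Pi.sub_apply, hvj, ← ha, ← hb, ← hc, ← hd]
  simp only [vecMul, dotProduct, ratMat, Matrix.map_apply, eq_intCast, Fin.sum_univ_four]
  linear_combination v 1 * hk' + v 3 * hl'

/-- Equivalence of integer row vectors under `Γ̃_{1,t}`. -/
def VecEquiv (t : ℕ) (x y : Fin 4 → ℤ) : Prop :=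
  ∃ g ∈ Gamma t, x ᵥ* (g : Matrix (Fin 4) (Fin 4) ℤ) = y

theorem VecEquiv.trans {t : ℕ} {x y z : Fin 4 → ℤ} (h : VecEquiv t x y) (h' : VecEquiv t y z) :
    VecEquiv t x z := by
  obtain ⟨g, hg, rfl⟩ := h
  obtain ⟨g', hg', rfl⟩ := h'
  exact ⟨g * g', mul_mem hg hg', by rw [Units.val_mul, vecMul_vecMul]⟩

theorem VecEquiv.symm {t : ℕ} {x y : Fin 4 → ℤ} (h : VecEquiv t x y) : VecEquiv t y x := by
  obtain ⟨g, hg, rfl⟩ := h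
  refine ⟨g⁻¹, inv_mem hg, ?_⟩
  rw [vecMul_vecMul, ← Units.val_mul, mul_inv_cancel, Units.val_one, vecMul_one]

/-- Integer vectors whose coordinates have no common divisor except units. -/
def Primitive (x : Fin 4 → ℤ) : Prop := ∀ d : ℤ, (∀ i, d ∣ x i) → IsUnit d

theorem dvd_vecMul {d : ℤ} {x : Fin 4 → ℤ} (h : ∀ i, d ∣ x i) (M : Matrix (Fin 4) (Fin 4) ℤ)
    (j : Fin 4) : d ∣ (x ᵥ* M) j := by
  simp only [vecMul, dotProduct]
  exact Finset.dvd_sum fun i _ => (h i).mul_right _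

theorem Primitive.of_vecEquiv {t : ℕ} {x y : Fin 4 → ℤ} (hx : Primitive x)
    (h : VecEquiv t x y) : Primitive y := by
  obtain ⟨g, -, rfl⟩ := h.symm
  exact fun d hd => hx d (dvd_vecMul hd _)

theorem exists_mem_Gamma_of_matrix {t : ℕ} (M N : Matrix (Fin 4) (Fin 4) ℤ) (hMN : M * N = 1)
    (hM : M * Lam ℤ t * Mᵀ = Lam ℤ t)
    (h1 : ∀ j, (t : ℤ) ∣ M 1 j - (1 : Matrix (Fin 4) (Fin 4) ℤ) 1 j)
    (h3 : ∀ j, (t : ℤ) ∣ M 3 j - (1 : Matrix (Fin 4) (Fin 4) ℤ) 3 j) :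
    ∃ g ∈ Gamma t, (g : Matrix (Fin 4) (Fin 4) ℤ) = M :=
  ⟨⟨M, N, hMN, mul_eq_one_comm.1 hMN⟩, mem_Gamma_of_dvd hM h1 h3, rfl⟩

/-- The copy of `SL(2, ℤ)` in `Γ̃_{1,t}` that acts on the first and third coordinates. -/
theorem vecEquiv_SL2 (t : ℕ) (p q r s : ℤ) (h : p * s - q * r = 1) (x : Fin 4 → ℤ) :
    VecEquiv t x ![x 0 * p + x 2 * r, x 1, x 0 * q + x 2 * s, x 3] := by
  obtain ⟨g, hg, hgM⟩ := exists_mem_Gamma_of_matrix (t := t)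
    !![p, 0, q, 0; 0, 1, 0, 0; r, 0, s, 0; 0, 0, 0, 1]
    !![s, 0, -q, 0; 0, 1, 0, 0; -r, 0, p, 0; 0, 0, 0, 1]
    (by
      ext i j
      fin_cases i <;> fin_cases j <;> simp [Matrix.mul_apply, Fin.sum_univ_four] <;>
        first | linear_combination h | ring1)
    (by
      ext i j
      fin_cases i <;> fin_cases j <;> simp [Matrix.mul_apply, Fin.sum_univ_four, Lam] <;>
        first | linear_combination h | linear_combination -h | ring1)
    (by intro j; fin_cases j <;> simp [Matrix.one_apply])
    (by intro j; fin_cases j <;> simp [Matrix.one_apply])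
  refine ⟨g, hg, ?_⟩
  rw [hgM]
  ext i
  fin_cases i <;> simp [vecMul, dotProduct, Fin.sum_univ_four]

/-- A product of two Eichler transformations in `Γ̃_{1,t}`. -/
theorem vecEquiv_eichler (t : ℕ) (k l : ℤ) (x : Fin 4 → ℤ) :
    VecEquiv t x ![x 0, x 1 + k * x 0, x 2 + t * (l * x 1 - k * x 3 + k * l * x 0),
      x 3 + l * x 0] := by
  obtain ⟨g, hg, hgM⟩ := exists_mem_Gamma_of_matrix (t := t)
    !![1, k, t * (k * l), l; 0, 1, t * l, 0; 0, 0, 1, 0; 0, 0, -(t * k), 1]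
    !![1, -k, -(t * (k * l)), -l; 0, 1, -(t * l), 0; 0, 0, 1, 0; 0, 0, t * k, 1]
    (by
      ext i j
      fin_cases i <;> fin_cases j <;> (simp [Matrix.mul_apply, Fin.sum_univ_four]; try ring))
    (by
      ext i j
      fin_cases i <;> fin_cases j <;> (simp [Matrix.mul_apply, Fin.sum_univ_four, Lam]; try ring))
    (by intro j; fin_cases j <;> simp [Matrix.one_apply])
    (by intro j; fin_cases j <;> simp [Matrix.one_apply])
  refine ⟨g, hg, ?_⟩
  rw [hgM]
  ext i
  fin_cases i <;> simp [vecMul, dotProduct, Fin.sum_univ_four] <;> ring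

/-! ### Orbits of primitive vectors -/

theorem exists_SL2_row_reduce (x y : ℤ) : ∃ p q r s : ℤ, p * s - q * r = 1 ∧
    x * p + y * r = Int.gcd x y ∧ x * q + y * s = 0 := by
  by_cases h : Int.gcd x y = 0
  · obtain ⟨rfl, rfl⟩ := Int.gcd_eq_zero_iff.1 h
    exact ⟨1, 0, 0, 1, by simp⟩
  · obtain ⟨a, ha⟩ := Int.gcd_dvd_left x y
    obtain ⟨b, hb⟩ := Int.gcd_dvd_right x y
    have hbez := Int.gcd_eq_gcd_ab x y
    set d : ℤ := (Int.gcd x y : ℤ)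
    have hd : d ≠ 0 := by simpa [d] using h
    refine ⟨x.gcdA y, -b, x.gcdB y, a, ?_, hbez.symm, ?_⟩
    · apply mul_left_cancel₀ hd
      linear_combination -(x.gcdA y) * ha - (x.gcdB y) * hb - hbez
    · linear_combination a * hb - b * ha

theorem vecEquiv_gcd (t : ℕ) (x : Fin 4 → ℤ) :
    VecEquiv t x ![Int.gcd (x 0) (x 2), x 1, 0, x 3] := by
  obtain ⟨p, q, r, s, h, h1, h2⟩ := exists_SL2_row_reduce (x 0) (x 2)
  simpa [h1, h2] using vecEquiv_SL2 t p q r s h x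

/-- The step of the reduction to normal form: an Eichler transformation changes the second and
fourth coordinates by multiples of `g` and puts a multiple of `t` into the third one, which
`SL(2, ℤ)` then absorbs into the first. -/
theorem vecEquiv_eichler_gcd (t : ℕ) (g a b k l : ℤ) :
    VecEquiv t ![g, a, 0, b]
      ![Int.gcd g (t * (l * a - k * b + k * l * g)), a + k * g, 0, b + l * g] := by
  have h := vecEquiv_eichler t k l ![g, a, 0, b]
  have h' := h.trans (vecEquiv_gcd t _)
  simpa using h'

/-- The classification of orbits of primitive vectors: a primitive vector `x` with
`gcd(t, x₀, x₂) = r` can be moved to `(r, a, 0, b)` for all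
integers `a`, `b` congruent to `x₁`, `x₃` modulo `r`. -/
theorem vecEquiv_normalForm {t r : ℕ} {x : Fin 4 → ℤ} (hx : Primitive x)
    (hr : Nat.gcd t (Int.gcd (x 0) (x 2)) = r) {a b : ℤ} (ha : (r : ℤ) ∣ a - x 1)
    (hb : (r : ℤ) ∣ b - x 3) : VecEquiv t x ![r, a, 0, b] := by
  set g := Int.gcd (x 0) (x 2) with hg
  obtain ⟨k, l, hkl⟩ : ∃ k l : ℤ, l * x 1 - k * x 3 = Int.gcd (x 1) (x 3) :=
    ⟨-(x 1).gcdB (x 3), (x 1).gcdA (x 3), by rw [Int.gcd_eq_gcd_ab]; ring⟩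
  have hcop : IsCoprime (g : ℤ) (Int.gcd (x 1) (x 3)) := by
    rw [Int.isCoprime_iff_gcd_eq_one]
    have : IsUnit (Int.gcd g (Int.gcd (x 1) (x 3)) : ℤ) := by
      apply hx
      have h1 := Int.gcd_dvd_left (g : ℤ) (Int.gcd (x 1) (x 3))
      have h2 := Int.gcd_dvd_right (g : ℤ) (Int.gcd (x 1) (x 3))
      intro i
      fin_cases i
      · exact h1.trans (Int.gcd_dvd_left _ _)
      · exact h2.trans (Int.gcd_dvd_left _ _)
      · exact h1.trans (Int.gcd_dvd_right _ _)
      · exact h2.trans (Int.gcd_dvd_right _ _)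
    simpa [Int.isUnit_iff_natAbs_eq] using this
  -- The Eichler transformation brings `t * gcd(x₁, x₃)` into the third coordinate.
  have h2 := vecEquiv_eichler_gcd t g (x 1) (x 3) k l
  have hgr : Int.gcd g (t * (l * x 1 - k * x 3 + k * l * g)) = r := by
    rw [hkl]
    have hc : IsCoprime (g : ℤ) (Int.gcd (x 1) (x 3) + k * l * g) :=
      IsCoprime.add_mul_right_right hcop _
    rw [Int.isCoprime_iff_gcd_eq_one] at hc
    rw [Int.gcd_mul_left_right_of_gcd_eq_one hc, Int.gcd_natCast_natCast, Nat.gcd_comm, hr]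
  rw [hgr] at h2
  have hrg : (r : ℤ) ∣ g := by
    rw [← hr]; exact_mod_cast Nat.gcd_dvd_right t g
  have hrt : (r : ℤ) ∣ t := by
    rw [← hr]; exact_mod_cast Nat.gcd_dvd_left t g
  obtain ⟨a', ha'⟩ : (r : ℤ) ∣ a - (x 1 + k * g) := by
    rw [← sub_sub]; exact dvd_sub ha (hrg.mul_left _)
  obtain ⟨b', hb'⟩ : (r : ℤ) ∣ b - (x 3 + l * g) := by
    rw [← sub_sub]; exact dvd_sub hb (hrg.mul_left _)
  have h3 := vecEquiv_eichler_gcd t r (x 1 + k * g) (x 3 + l * g) a' b'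
  have hlast : Int.gcd r (t * (b' * (x 1 + k * g) - a' * (x 3 + l * g) + a' * b' * r)) = r := by
    exact_mod_cast Int.gcd_eq_left (Int.natCast_nonneg r) (hrt.mul_right _)
  rw [hlast] at h3
  have e1 : x 1 + k * g + a' * r = a := by linear_combination -ha'
  have e2 : x 3 + l * g + b' * r = b := by linear_combination -hb'
  rw [e1, e2] at h3
  exact ((vecEquiv_gcd t x).trans h2).trans h3

/-- Modulo a common divisor `r` of `t`, `x₀` and `x₂`, only the second and fourth rows of `g`
contribute to `x g`, and these are rows of the identity. -/
theorem dvd_vecMul_sub {t : ℕ} (ht : t ≠ 0) {g : GL (Fin 4) ℤ} (hg : g ∈ Gamma t)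
    {r : ℤ} (hr : r ∣ t) (x : Fin 4 → ℤ) (h0 : r ∣ x 0) (h2 : r ∣ x 2) (j : Fin 4) :
    r ∣ (x ᵥ* (g : Matrix (Fin 4) (Fin 4) ℤ)) j
      - (x 1 * (1 : Matrix (Fin 4) (Fin 4) ℤ) 1 j + x 3 * (1 : Matrix (Fin 4) (Fin 4) ℤ) 3 j) := by
  have h1 := hr.trans (dvd_row_of_mem_Gamma ht hg (Or.inl rfl) j)
  have h3 := hr.trans (dvd_row_of_mem_Gamma ht hg (Or.inr rfl) j)
  have := ((h0.mul_right ((g : Matrix (Fin 4) (Fin 4) ℤ) 0 j)).add (h1.mul_left (x 1))).add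
    ((h2.mul_right ((g : Matrix (Fin 4) (Fin 4) ℤ) 2 j)).add (h3.mul_left (x 3)))
  refine this.trans (dvd_of_eq ?_)
  simp only [vecMul, dotProduct, Fin.sum_univ_four]
  ring

/-- A vector is fixed by `Γ̃_{1,t}` modulo every common divisor of `t`, `x₀` and `x₂`. -/
theorem VecEquiv.dvd {t : ℕ} (ht : t ≠ 0) {x y : Fin 4 → ℤ} (h : VecEquiv t x y)
    {r : ℤ} (hr : r ∣ t) (h0 : r ∣ x 0) (h2 : r ∣ x 2) :
    r ∣ y 0 ∧ r ∣ y 1 - x 1 ∧ r ∣ y 2 ∧ r ∣ y 3 - x 3 := by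
  obtain ⟨g, hg, rfl⟩ := h
  have := dvd_vecMul_sub ht hg hr x h0 h2
  have a0 := this 0
  have a1 := this 1
  have a2 := this 2
  have a3 := this 3
  simp at a0 a1 a2 a3
  exact ⟨a0, a1, a2, a3⟩

/-- `gcd(t, x₀, x₂)` is an invariant of the orbit of `x`. -/
theorem VecEquiv.gcd_eq {t : ℕ} (ht : t ≠ 0) {x y : Fin 4 → ℤ} (h : VecEquiv t x y) :
    Nat.gcd t (Int.gcd (x 0) (x 2)) = Nat.gcd t (Int.gcd (y 0) (y 2)) := by
  have key : ∀ {x y : Fin 4 → ℤ}, VecEquiv t x y →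
      Nat.gcd t (Int.gcd (x 0) (x 2)) ∣ Nat.gcd t (Int.gcd (y 0) (y 2)) := by
    intro x y h
    have ht1 : ((Nat.gcd t (Int.gcd (x 0) (x 2)) : ℕ) : ℤ) ∣ t := by
      exact_mod_cast Nat.gcd_dvd_left _ _
    have hx : ((Nat.gcd t (Int.gcd (x 0) (x 2)) : ℕ) : ℤ) ∣ (Int.gcd (x 0) (x 2) : ℕ) := by
      exact_mod_cast Nat.gcd_dvd_right _ _
    obtain ⟨a, -, b, -⟩ := h.dvd ht ht1 (hx.trans (Int.gcd_dvd_left _ _))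
      (hx.trans (Int.gcd_dvd_right _ _))
    refine Nat.dvd_gcd (Nat.gcd_dvd_left _ _) ?_
    exact_mod_cast Int.dvd_coe_gcd a b
  exact Nat.dvd_antisymm (key h) (key h.symm)

/-! ### Primitive vectors and rational lines -/

theorem toRat_add (x y : Fin 4 → ℤ) : toRat (x + y) = toRat x + toRat y := by
  ext i; simp [toRat]

theorem toRat_smul (m : ℤ) (x : Fin 4 → ℤ) : toRat (m • x) = (m : ℚ) • toRat x := by
  ext i; simp [toRat]

theorem toRat_injective : Function.Injective toRat := by
  intro x y h
  ext i
  have := congrFun h i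
  simpa [toRat] using this

theorem toRat_cons (a b c d : ℤ) : toRat ![a, b, c, d] = ![(a : ℚ), b, c, d] := by
  ext i
  fin_cases i <;> simp [toRat]

theorem toRat_ne_zero {x : Fin 4 → ℤ} (hx : x ≠ 0) : toRat x ≠ 0 := by
  intro h
  exact hx (toRat_injective (h.trans (by ext i; simp [toRat])))

theorem primitive_of_dotProduct {x y : Fin 4 → ℤ} (h : x ⬝ᵥ y = 1) : Primitive x := by
  intro d hd
  apply isUnit_of_dvd_one
  rw [← h]
  exact Finset.dvd_sum fun i _ => (hd i).mul_right _

theorem Primitive.exists_dotProduct {x : Fin 4 → ℤ} (hx : Primitive x) :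
    ∃ y : Fin 4 → ℤ, x ⬝ᵥ y = 1 := by
  obtain ⟨d, hd⟩ := (inferInstance : (Ideal.span (Set.range x)).IsPrincipal)
  have hdu : IsUnit d := by
    refine hx d fun i => ?_
    rw [← Ideal.mem_span_singleton, ← Ideal.submodule_span_eq, ← hd]
    exact Ideal.subset_span ⟨i, rfl⟩
  have h1 : (1 : ℤ) ∈ Ideal.span (Set.range x) := by
    rw [hd, Ideal.submodule_span_eq, Ideal.span_singleton_eq_top.2 hdu]
    trivial
  obtain ⟨c, hc⟩ := Ideal.mem_span_range_iff_exists_fun.1 h1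
  exact ⟨c, by rw [← hc, dotProduct]; exact Finset.sum_congr rfl fun i _ => mul_comm _ _⟩

theorem Primitive.ne_zero {x : Fin 4 → ℤ} (hx : Primitive x) : x ≠ 0 := by
  rintro rfl
  simpa using hx 0 (by simp)

theorem exists_primitive_of_int {x : Fin 4 → ℤ} (hx : x ≠ 0) :
    ∃ (d : ℤ) (y : Fin 4 → ℤ), d ≠ 0 ∧ Primitive y ∧ x = d • y := by
  obtain ⟨i, hi⟩ := Function.ne_iff.1 hx
  obtain ⟨y, hy, hy1⟩ := Finset.extract_gcd x (s := Finset.univ) ⟨0, Finset.mem_univ _⟩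
  refine ⟨Finset.univ.gcd x, y, ?_, ?_, ?_⟩
  · intro h
    exact hi (Finset.gcd_eq_zero_iff.1 h i (Finset.mem_univ _))
  · intro d hd
    apply isUnit_of_dvd_one
    rw [← hy1]
    exact Finset.dvd_gcd fun i _ => hd i
  · ext j
    simpa using hy j (Finset.mem_univ _)

theorem exists_primitive_of_rat {v : Fin 4 → ℚ} (hv : v ≠ 0) :
    ∃ (c : ℚ) (x : Fin 4 → ℤ), c ≠ 0 ∧ Primitive x ∧ v = c • toRat x := by
  obtain ⟨b, hb⟩ := IsLocalization.exist_integer_multiples_of_finite (nonZeroDivisors ℤ) v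
  choose z hz using hb
  have hb0 : ((b : ℤ) : ℚ) ≠ 0 := by
    exact_mod_cast nonZeroDivisors.coe_ne_zero b
  have hz' : toRat z = ((b : ℤ) : ℚ) • v := by
    ext i
    have := hz i
    simp only [Algebra.smul_def, eq_intCast] at this
    simpa [toRat] using this
  have hz0 : z ≠ 0 := by
    rintro rfl
    have : ((b : ℤ) : ℚ) • v = 0 := by rw [← hz']; ext i; simp [toRat]
    exact (smul_ne_zero hb0 hv) this
  obtain ⟨d, y, hd, hy, rfl⟩ := exists_primitive_of_int hz0
  refine ⟨((b : ℤ) : ℚ)⁻¹ * d, y, ?_, hy, ?_⟩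
  · have : (d : ℚ) ≠ 0 := by exact_mod_cast hd
    positivity
  · rw [mul_smul, ← toRat_smul, hz', smul_smul, inv_mul_cancel₀ hb0, one_smul]

theorem exists_primitive_mem {U : Submodule ℚ (Fin 4 → ℚ)} {v : Fin 4 → ℚ} (hvU : v ∈ U)
    (hv : v ≠ 0) :
    ∃ (c : ℚ) (x : Fin 4 → ℤ), c ≠ 0 ∧ Primitive x ∧ toRat x ∈ U ∧ v = c • toRat x := by
  obtain ⟨c, x, hc, hx, rfl⟩ := exists_primitive_of_rat hv
  refine ⟨c, x, hc, hx, ?_, rfl⟩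
  have := U.smul_mem c⁻¹ hvU
  rwa [smul_smul, inv_mul_cancel₀ hc, one_smul] at this

theorem Primitive.eq_or_eq_neg {x y : Fin 4 → ℤ} (hx : Primitive x) (hy : Primitive y)
    {c : ℚ} (h : toRat x = c • toRat y) : x = y ∨ x = -y := by
  obtain ⟨z, hz⟩ := hy.exists_dotProduct
  -- `c` is the integer `x ⬝ᵥ z`.
  have hc : c = ((x ⬝ᵥ z : ℤ) : ℚ) := by
    have h1 : ((x ⬝ᵥ z : ℤ) : ℚ) = toRat x ⬝ᵥ toRat z := by simp [dotProduct, toRat]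
    have h2 : ((y ⬝ᵥ z : ℤ) : ℚ) = toRat y ⬝ᵥ toRat z := by simp [dotProduct, toRat]
    rw [h1, h, smul_dotProduct, ← h2, hz]
    simp
  rw [hc, ← toRat_smul] at h
  have h' := toRat_injective h
  have hu : IsUnit (x ⬝ᵥ z) := hx _ fun i => ⟨y i, by rw [congrFun h' i]; simp⟩
  rcases Int.isUnit_iff.1 hu with hu | hu <;> rw [hu] at h'
  · left; simpa using h'
  · right; simpa using h'

/-! ### Isotropic subspaces and adjacency in the building -/

theorem vertexOf_eq_iff {t : ℕ} {U V : IsoSubspace t} :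
    vertexOf U = vertexOf V ↔ ∃ g ∈ Gamma t, act U.1 g = V.1 :=
  Quotient.eq (r := isoSetoid t)

theorem vertexOf_eq_of_val_eq {t : ℕ} {U V : IsoSubspace t} (h : U.1 = V.1) :
    vertexOf U = vertexOf V := by
  rw [Subtype.ext h]

theorem toRat_vecMul_mem_act {U : Submodule ℚ (Fin 4 → ℚ)} {x : Fin 4 → ℤ} (h : toRat x ∈ U)
    (g : GL (Fin 4) ℤ) : toRat (x ᵥ* (g : Matrix (Fin 4) (Fin 4) ℤ)) ∈ act U g := by
  rw [toRat_vecMul]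
  exact ⟨_, h, rfl⟩

theorem act_span_singleton (x : Fin 4 → ℤ) (g : GL (Fin 4) ℤ) :
    act (Submodule.span ℚ {toRat x}) g
      = Submodule.span ℚ {toRat (x ᵥ* (g : Matrix (Fin 4) (Fin 4) ℤ))} := by
  rw [act, Submodule.map_span, Set.image_singleton, toRat_vecMul]
  rfl

theorem finrank_act (U : Submodule ℚ (Fin 4 → ℚ)) (g : GL (Fin 4) ℤ) :
    Module.finrank ℚ (act U g) = Module.finrank ℚ U := by
  refine le_antisymm (Submodule.finrank_map_le _ _) ?_
  conv_lhs => rw [← act_one U, ← mul_inv_cancel g, act_mul]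
  exact Submodule.finrank_map_le _ _

theorem isLineVertex_vertexOf {t : ℕ} {U : IsoSubspace t} :
    IsLineVertex (vertexOf U) ↔ Module.finrank ℚ U.1 = 1 := by
  refine ⟨?_, fun h => ⟨U, rfl, h⟩⟩
  rintro ⟨V, hV, h⟩
  obtain ⟨g, -, hg⟩ := vertexOf_eq_iff.1 hV
  rw [← hg, finrank_act, h]

theorem isPlaneVertex_vertexOf {t : ℕ} {U : IsoSubspace t} :
    IsPlaneVertex (vertexOf U) ↔ Module.finrank ℚ U.1 = 2 := by
  refine ⟨?_, fun h => ⟨U, rfl, h⟩⟩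
  rintro ⟨V, hV, h⟩
  obtain ⟨g, -, hg⟩ := vertexOf_eq_iff.1 hV
  rw [← hg, finrank_act, h]

/-- The alternating form `α` as a bilinear form. -/
def bilin (t : ℕ) : LinearMap.BilinForm ℚ (Fin 4 → ℚ) := Matrix.toBilin' (Lam ℚ t)

theorem bilin_apply (t : ℕ) (x y : Fin 4 → ℚ) : bilin t x y = form t x y := by
  rw [bilin, Matrix.toBilin'_apply', form]

theorem finrank_le_two {t : ℕ} (ht : t ≠ 0) {U : Submodule ℚ (Fin 4 → ℚ)}
    (hU : IsIsotropic t U) : Module.finrank ℚ U ≤ 2 := by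
  have ht' : (t : ℚ) ≠ 0 := by exact_mod_cast ht
  have hrefl : (bilin t).IsRefl := by
    intro x y h
    rw [bilin_apply, form_eq] at h ⊢
    linarith
  have hnd : (bilin t).Nondegenerate := by
    refine (hrefl.nondegenerate_iff_separatingLeft).2 fun x hx => ?_
    have h0 := hx (Pi.single 2 1)
    have h1 := hx (Pi.single 3 1)
    have h2 := hx (Pi.single 0 1)
    have h3 := hx (Pi.single 1 1)
    simp [bilin_apply, form_eq, ht] at h0 h1 h2 h3
    ext i
    fin_cases i <;> assumption
  have h1 := LinearMap.BilinForm.finrank_orthogonal hnd U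
  have h2 : U ≤ (bilin t).orthogonal U := by
    intro y hy x hx
    exact (bilin_apply t x y).trans (hU x hx y hy)
  have h3 := Submodule.finrank_mono h2
  have h4 : Module.finrank ℚ (Fin 4 → ℚ) = 4 := by simp
  omega

theorem finrank_pos {t : ℕ} (U : IsoSubspace t) : 0 < Module.finrank ℚ U.1 := by
  rw [Nat.pos_iff_ne_zero, Ne, Submodule.finrank_eq_zero]
  exact U.2.1

theorem finrank_eq_one_or_two {t : ℕ} (ht : t ≠ 0) (U : IsoSubspace t) :
    Module.finrank ℚ U.1 = 1 ∨ Module.finrank ℚ U.1 = 2 := by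
  have h1 := finrank_pos U
  have h2 := finrank_le_two ht U.2.2
  omega

theorem xor_isLineVertex_isPlaneVertex {t : ℕ} (ht : t ≠ 0) (x : Vertex t) :
    Xor (IsLineVertex x) (IsPlaneVertex x) := by
  induction x using Quotient.inductionOn with
  | h U =>
    change Xor (IsLineVertex (vertexOf U)) (IsPlaneVertex (vertexOf U))
    rw [isLineVertex_vertexOf, isPlaneVertex_vertexOf]
    rcases finrank_eq_one_or_two ht U with h | h <;> simp [h, Xor]

/-- Adjacency is tested on any representatives of the two orbits. -/
theorem exists_act_le_of_adj {t : ℕ} {U V : IsoSubspace t}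
    (h : (building t).Adj (vertexOf U) (vertexOf V)) :
    ∃ g ∈ Gamma t, act U.1 g ≤ V.1 ∨ V.1 ≤ act U.1 g := by
  obtain ⟨-, U', V', hU, hV, g, hg, h⟩ := h
  obtain ⟨a, ha, ha'⟩ := vertexOf_eq_iff.1 hU.symm
  obtain ⟨b, hb, hb'⟩ := vertexOf_eq_iff.1 hV
  refine ⟨a * g * b, mul_mem (mul_mem ha hg) hb, ?_⟩
  rw [act_mul, act_mul, ha', ← hb']
  exact h.imp (fun h => act_mono h b) (fun h => act_mono h b)

theorem building_adj_iff_exists {t : ℕ} {U V : IsoSubspace t} (hU : Module.finrank ℚ U.1 = 1)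
    (hV : Module.finrank ℚ V.1 = 2) :
    (building t).Adj (vertexOf U) (vertexOf V) ↔ ∃ g ∈ Gamma t, act U.1 g ≤ V.1 := by
  constructor
  · intro h
    obtain ⟨g, hg, h | h⟩ := exists_act_le_of_adj h
    · exact ⟨g, hg, h⟩
    · have := Submodule.finrank_mono h
      rw [finrank_act, hU, hV] at this
      omega
  · rintro ⟨g, hg, h⟩
    refine ⟨fun he => ?_, U, V, rfl, rfl, g, hg, Or.inl h⟩
    have h1 := isLineVertex_vertexOf.2 hU
    rw [he, isLineVertex_vertexOf, hV] at h1
    omega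

theorem isLineVertex_and_isPlaneVertex_of_adj {t : ℕ} (ht : t ≠ 0) {x y : Vertex t}
    (h : (building t).Adj x y) :
    (IsLineVertex x ∧ IsPlaneVertex y) ∨ (IsPlaneVertex x ∧ IsLineVertex y) := by
  have hne := h.ne
  induction x using Quotient.inductionOn with
  | h U =>
  induction y using Quotient.inductionOn with
  | h V =>
    change (IsLineVertex (vertexOf U) ∧ IsPlaneVertex (vertexOf V)) ∨
      (IsPlaneVertex (vertexOf U) ∧ IsLineVertex (vertexOf V))
    simp only [isLineVertex_vertexOf, isPlaneVertex_vertexOf]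
    have hd : Module.finrank ℚ U.1 ≠ Module.finrank ℚ V.1 := by
      intro hd
      apply hne
      change vertexOf U = vertexOf V
      rw [vertexOf_eq_iff]
      obtain ⟨g, hg, h | h⟩ := exists_act_le_of_adj h
      · exact ⟨g, hg, Submodule.eq_of_le_of_finrank_eq h (by rw [finrank_act, hd])⟩
      · exact ⟨g, hg, (Submodule.eq_of_le_of_finrank_eq h (by rw [finrank_act, hd])).symm⟩
    rcases finrank_eq_one_or_two ht U with h1 | h1 <;>
      rcases finrank_eq_one_or_two ht V with h2 | h2 <;> simp_all

/-! ### The index sets `𝒩(n)` and `ℳ(n)` -/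

/-- Membership in `𝒩(n)` as the Bézout identity for `gcd(n, a, b) = 1`;
the converse is `residue_mem_NN_of_bezout`. -/
theorem exists_bezout_of_mem_NN {n : ℕ} (hn : n ≠ 0) {a b : ℤ} (h : residue n a b ∈ NN n) :
    ∃ α β γ : ℤ, α * n + β * a + γ * b = 1 := by
  have h1 : IsCoprime (n : ℤ) (Int.gcd a b) := by
    rw [Int.isCoprime_iff_gcd_eq_one, Int.gcd_natCast_natCast]
    obtain ⟨e, he⟩ := Nat.gcd_dvd_left n (Int.gcd a b)
    have hd : ((Nat.gcd n (Int.gcd a b) : ℕ) : ℤ) ∣ (Int.gcd a b : ℕ) := by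
      exact_mod_cast Nat.gcd_dvd_right n (Int.gcd a b)
    obtain ⟨a', ha'⟩ := hd.trans (Int.gcd_dvd_left a b)
    obtain ⟨b', hb'⟩ := hd.trans (Int.gcd_dvd_right a b)
    set d := Nat.gcd n (Int.gcd a b)
    have he0 : e ≠ 0 := by rintro rfl; exact hn (by simpa using he)
    have he' : (n : ℤ) = d * e := by exact_mod_cast he
    -- The class of `e = n / d` kills `(a, b)`, so it vanishes modulo `n`.
    have hz : ((e : ℤ) : ZMod n) = 0 := by
      by_contra hne
      refine h _ hne (Prod.ext ?_ ?_)
      · change ((e : ℤ) : ZMod n) * (a : ZMod n) = 0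
        rw [← Int.cast_mul, ZMod.intCast_zmod_eq_zero_iff_dvd]
        exact ⟨a', by rw [ha', he']; ring⟩
      · change ((e : ℤ) : ZMod n) * (b : ZMod n) = 0
        rw [← Int.cast_mul, ZMod.intCast_zmod_eq_zero_iff_dvd]
        exact ⟨b', by rw [hb', he']; ring⟩
    rw [ZMod.intCast_zmod_eq_zero_iff_dvd, Int.natCast_dvd_natCast, he] at hz
    exact Nat.dvd_one.1 (Nat.dvd_of_mul_dvd_mul_right (Nat.pos_of_ne_zero he0) (by simpa using hz))
  obtain ⟨u, v, huv⟩ := h1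
  rw [Int.gcd_eq_gcd_ab] at huv
  exact ⟨u, v * a.gcdA b, v * a.gcdB b, by linear_combination huv⟩

theorem residue_mem_NN_of_bezout {n : ℕ} {a b α β γ : ℤ} (h : α * n + β * a + γ * b = 1) :
    residue n a b ∈ NN n := by
  intro c hc h0
  apply hc
  have h1 : c * (a : ZMod n) = 0 := congrArg Prod.fst h0
  have h2 : c * (b : ZMod n) = 0 := congrArg Prod.snd h0
  have h' := congrArg (Int.cast : ℤ → ZMod n) h
  push_cast at h'
  rw [ZMod.natCast_self] at h'
  linear_combination (-c) * h' + (β : ZMod n) * h1 + (γ : ZMod n) * h2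

theorem residue_eq_iff {n : ℕ} {a b a' b' : ℤ} :
    residue n a b = residue n a' b' ↔ (n : ℤ) ∣ a - a' ∧ (n : ℤ) ∣ b - b' := by
  simp only [residue, Prod.mk.injEq, ← ZMod.intCast_zmod_eq_zero_iff_dvd, Int.cast_sub, sub_eq_zero]

theorem neg_residue (n : ℕ) (a b : ℤ) : -residue n a b = residue n (-a) (-b) := by
  simp [residue]

theorem residue_cast {n : ℕ} (p : ZMod n × ZMod n) :
    residue n (p.1.cast : ℤ) (p.2.cast : ℤ) = p := by
  simp [residue]

/-! ### Orbits of lines -/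

theorem line_val (t : ℕ) {r : ℕ} (hr : r ≠ 0) (a b : ℤ) :
    (line t hr a b).1 = Submodule.span ℚ {toRat ![(r : ℤ), a, 0, b]} := by
  rw [toRat_cons]
  simp [line]

theorem line0_val (t : ℕ) : (line0 t).1 = (line t one_ne_zero 0 0).1 := by
  simp [line, line0, v0]

theorem primitive_line {r : ℕ} (hr : r ≠ 0) {a b : ℤ} (h : residue r a b ∈ NN r) :
    Primitive ![(r : ℤ), a, 0, b] := by
  obtain ⟨α, β, γ, h⟩ := exists_bezout_of_mem_NN hr h
  apply primitive_of_dotProduct (y := ![α, β, 0, γ])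
  simp [dotProduct, Fin.sum_univ_four]
  linear_combination h

theorem residue_mem_NN_of_primitive {r : ℕ} {x : Fin 4 → ℤ} (hx : Primitive x)
    (h0 : (r : ℤ) ∣ x 0) (h2 : (r : ℤ) ∣ x 2) : residue r (x 1) (x 3) ∈ NN r := by
  obtain ⟨y, hy⟩ := hx.exists_dotProduct
  obtain ⟨c, hc⟩ := h0
  obtain ⟨d, hd⟩ := h2
  apply residue_mem_NN_of_bezout (α := c * y 0 + d * y 2) (β := y 1) (γ := y 3)
  simp only [dotProduct, Fin.sum_univ_four, hc, hd] at hy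
  linear_combination hy

/-- The normal form of the orbit of a line with primitive generator `x`; its parameters `a`, `b` may
be changed modulo `r`. -/
theorem vertexOf_eq_line {t r : ℕ} (hr0 : r ≠ 0) {U : IsoSubspace t} {x : Fin 4 → ℤ}
    (hU : U.1 = Submodule.span ℚ {toRat x}) (hx : Primitive x)
    (hr : Nat.gcd t (Int.gcd (x 0) (x 2)) = r) {a b : ℤ} (ha : (r : ℤ) ∣ a - x 1)
    (hb : (r : ℤ) ∣ b - x 3) : vertexOf U = vertexOf (line t hr0 a b) := by
  obtain ⟨g, hg, hgx⟩ := vecEquiv_normalForm hx hr ha hb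
  rw [vertexOf_eq_iff]
  exact ⟨g, hg, by rw [hU, act_span_singleton, hgx, line_val]⟩

theorem vertexOf_line_eq_iff {t r r' : ℕ} (ht : t ≠ 0) (hr0 : r ≠ 0) (hr0' : r' ≠ 0)
    (hr : r ∣ t) (hr' : r' ∣ t) {a b a' b' : ℤ} (h : residue r a b ∈ NN r)
    (h' : residue r' a' b' ∈ NN r') :
    vertexOf (line t hr0 a b) = vertexOf (line t hr0' a' b') ↔
      r = r' ∧ (residue r a' b' = residue r a b ∨ residue r a' b' = -residue r a b) := by
  have hgcd : Nat.gcd t (Int.gcd r 0) = r := by simp [Nat.gcd_eq_right hr]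
  have hgcd' : Nat.gcd t (Int.gcd r' 0) = r' := by simp [Nat.gcd_eq_right hr']
  constructor
  · intro he
    obtain ⟨g, hg, hge⟩ := vertexOf_eq_iff.1 he
    rw [line_val, line_val, act_span_singleton] at hge
    have hmem : toRat (![(r : ℤ), a, 0, b] ᵥ* (g : Matrix (Fin 4) (Fin 4) ℤ)) ∈
        Submodule.span ℚ {toRat ![(r' : ℤ), a', 0, b']} := by
      rw [← hge]; exact Submodule.mem_span_singleton_self _
    obtain ⟨c, hc⟩ := Submodule.mem_span_singleton.1 hmem
    have hx := primitive_line hr0 h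
    have hrt : (r : ℤ) ∣ t := by exact_mod_cast hr
    rcases Primitive.eq_or_eq_neg (hx.of_vecEquiv ⟨g, hg, rfl⟩) (primitive_line hr0' h')
      hc.symm with h1 | h1
    · have hv : VecEquiv t _ _ := ⟨g, hg, h1⟩
      have hrr : r = r' := by
        have := hv.gcd_eq ht
        simpa [Nat.gcd_eq_right hr, Nat.gcd_eq_right hr'] using this
      have := hv.dvd ht hrt (by simp) (by simp)
      refine ⟨hrr, Or.inl (residue_eq_iff.2 ?_)⟩
      simpa using ⟨this.2.1, this.2.2.2⟩
    · have hv : VecEquiv t _ _ := ⟨g, hg, h1⟩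
      have hrr : r = r' := by
        have := hv.gcd_eq ht
        simpa [Nat.gcd_eq_right hr, Nat.gcd_eq_right hr'] using this
      have := hv.dvd ht hrt (by simp) (by simp)
      refine ⟨hrr, Or.inr ?_⟩
      rw [neg_residue, residue_eq_iff]
      have h3 := this.2.1
      have h4 := this.2.2.2
      simp at h3 h4
      constructor
      · exact dvd_neg.1 (h3.trans (dvd_of_eq (by ring)))
      · exact dvd_neg.1 (h4.trans (dvd_of_eq (by ring)))
  · rintro ⟨rfl, he | he⟩
    · obtain ⟨h1, h2⟩ := residue_eq_iff.1 he
      exact vertexOf_eq_line _ (line_val t _ _ _) (primitive_line hr0 h) (by simpa using hgcd)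
        (by simpa using h1) (by simpa using h2)
    · -- The same line is spanned by `(-r, -a, 0, -b)`.
      rw [neg_residue] at he
      obtain ⟨h1, h2⟩ := residue_eq_iff.1 he
      have hval : (line t hr0 a b).1 = Submodule.span ℚ {toRat (-![(r : ℤ), a, 0, b])} := by
        have hneg : toRat (-![(r : ℤ), a, 0, b]) = -toRat ![(r : ℤ), a, 0, b] := by
          ext i
          simp [toRat]
        rw [line_val, hneg, ← Set.neg_singleton, Submodule.span_neg]
      refine vertexOf_eq_line _ hval ?_ (by simpa using hgcd) (by simpa using h1)
        (by simpa using h2)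
      exact fun d hd => primitive_line hr0 h d fun i => by simpa using hd i

/-- The line vertex attached to a divisor `r` of `t` and a class in `ℳ(r)`. For `r = 1` this is
the orbit of `ℓ₀`. -/
def lineVertex {t : ℕ} (ht : t ≠ 0) (i : Σ r : {r : ℕ // r ∣ t}, MM r.1) : Vertex t :=
  Quotient.lift (s := signSetoid i.1.1)
    (fun p : NN i.1.1 => vertexOf (line t (ne_zero_of_dvd_ne_zero ht i.1.2)
      (p.1.1.cast : ℤ) (p.1.2.cast : ℤ)))
    (fun p q h => (vertexOf_line_eq_iff ht _ _ i.1.2 i.1.2 (by rw [residue_cast]; exact p.2)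
      (by rw [residue_cast]; exact q.2)).2 ⟨rfl, by rw [residue_cast, residue_cast]; exact h⟩) i.2

theorem lineVertex_mk {t : ℕ} (ht : t ≠ 0) (r : {r : ℕ // r ∣ t}) (a b : ℤ)
    (hab : residue r.1 a b ∈ NN r.1) :
    lineVertex ht ⟨r, MM.mk ⟨residue r.1 a b, hab⟩⟩ =
      vertexOf (line t (ne_zero_of_dvd_ne_zero ht r.2) a b) :=
  (vertexOf_line_eq_iff ht _ _ r.2 r.2 (by rw [residue_cast]; exact hab) hab).2
    ⟨rfl, Or.inl (residue_cast _).symm⟩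

theorem MM.exists_rep {n : ℕ} (m : MM n) :
    ∃ (a b : ℤ) (hab : residue n a b ∈ NN n), m = MM.mk ⟨residue n a b, hab⟩ := by
  induction m using Quotient.inductionOn with
  | h p =>
    have hp : residue n (p.1.1.cast : ℤ) (p.1.2.cast : ℤ) = p.1 := residue_cast _
    exact ⟨_, _, by rw [hp]; exact p.2, congrArg MM.mk (Subtype.ext hp.symm)⟩

theorem MM.mk_eq_mk {n : ℕ} {p q : NN n} : MM.mk p = MM.mk q ↔ q.1 = p.1 ∨ q.1 = -p.1 :=
  Quotient.eq (r := signSetoid n)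

theorem lineVertex_injective {t : ℕ} (ht : t ≠ 0) : Function.Injective (lineVertex ht) := by
  rintro ⟨r, m⟩ ⟨r', m'⟩ h
  obtain ⟨a, b, hab, rfl⟩ := m.exists_rep
  obtain ⟨a', b', hab', rfl⟩ := m'.exists_rep
  rw [lineVertex_mk, lineVertex_mk, vertexOf_line_eq_iff ht _ _ r.2 r'.2 hab hab'] at h
  obtain ⟨hr, h⟩ := h
  obtain rfl : r = r' := Subtype.ext hr
  have hm : MM.mk ⟨_, hab⟩ = MM.mk ⟨_, hab'⟩ := MM.mk_eq_mk.2 h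
  rw [hm]

theorem range_lineVertex {t : ℕ} (ht : t ≠ 0) :
    Set.range (lineVertex ht) = {x | IsLineVertex x} := by
  apply Set.Subset.antisymm
  · rintro _ ⟨⟨r, m⟩, rfl⟩
    obtain ⟨a, b, hab, rfl⟩ := m.exists_rep
    have hr0 := ne_zero_of_dvd_ne_zero ht r.2
    rw [lineVertex_mk, Set.mem_ofPred_eq, isLineVertex_vertexOf, line_val]
    exact finrank_span_singleton (toRat_ne_zero (primitive_line hr0 hab).ne_zero)
  · rintro _ ⟨U, rfl, hU⟩
    obtain ⟨v, hv, hv'⟩ := finrank_eq_one_iff'.1 hU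
    have hv0 : (v : Fin 4 → ℚ) ≠ 0 := fun h => hv (Subtype.ext h)
    obtain ⟨c, x, hc, hx, hxU, hvx⟩ := exists_primitive_mem v.2 hv0
    have hUx : U.1 = Submodule.span ℚ {toRat x} := by
      apply le_antisymm
      · intro w hw
        obtain ⟨d, hd⟩ := hv' ⟨w, hw⟩
        refine Submodule.mem_span_singleton.2 ⟨d * c, ?_⟩
        rw [mul_smul, ← hvx]
        exact congrArg Subtype.val hd
      · exact (Submodule.span_singleton_le_iff_mem _ _).2 hxU
    have hr : Nat.gcd t (Int.gcd (x 0) (x 2)) ∣ t := Nat.gcd_dvd_left _ _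
    have hr2 : ((Nat.gcd t (Int.gcd (x 0) (x 2)) : ℕ) : ℤ) ∣ (Int.gcd (x 0) (x 2) : ℕ) := by
      exact_mod_cast Nat.gcd_dvd_right _ _
    have hNN := residue_mem_NN_of_primitive hx (hr2.trans (Int.gcd_dvd_left _ _))
      (hr2.trans (Int.gcd_dvd_right _ _))
    refine ⟨⟨⟨_, hr⟩, MM.mk ⟨_, hNN⟩⟩, ?_⟩
    rw [lineVertex_mk]
    exact (vertexOf_eq_line _ hUx hx rfl (by simp) (by simp)).symm

theorem vertexOf_line0 {t : ℕ} (ht : t ≠ 0) (m : MM 1) :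
    lineVertex ht ⟨⟨1, one_dvd t⟩, m⟩ = vertexOf (line0 t) := by
  obtain ⟨a, b, hab, rfl⟩ := m.exists_rep
  rw [lineVertex_mk, vertexOf_eq_of_val_eq (line0_val t), vertexOf_line_eq_iff ht _ _ (one_dvd t)
    (one_dvd t) hab (fun c hc => (hc (Subsingleton.elim _ _)).elim)]
  exact ⟨rfl, Or.inl (Subsingleton.elim _ _)⟩

/-! ### Orbits of isotropic planes -/

theorem form_vecMul {t : ℕ} {g : GL (Fin 4) ℤ} (hg : g ∈ Gamma t) (x y : Fin 4 → ℚ) :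
    form t (x ᵥ* ratMat g) (y ᵥ* ratMat g) = form t x y := by
  have h : ratMat g * Lam ℚ t * (ratMat g)ᵀ = Lam ℚ t := by
    have h1 : (g : Matrix (Fin 4) (Fin 4) ℤ) * Lam ℤ t * (g : Matrix (Fin 4) (Fin 4) ℤ)ᵀ
      = Lam ℤ t := hg.1
    have h2 : (Lam ℤ t).map (Int.castRingHom ℚ) = Lam ℚ t := by
      ext i j
      fin_cases i <;> fin_cases j <;> simp [Lam]
    have h3 := congrArg (fun M => M.map (Int.castRingHom ℚ)) h1
    simp only [Matrix.map_mul, h2] at h3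
    exact h3
  conv_rhs => rw [form, ← h]
  rw [form, ← dotProduct_mulVec, ← mulVec_transpose, mulVec_mulVec, mulVec_mulVec, Matrix.mul_assoc]

theorem isIsotropic_act {t : ℕ} {g : GL (Fin 4) ℤ} (hg : g ∈ Gamma t)
    {U : Submodule ℚ (Fin 4 → ℚ)} (hU : IsIsotropic t U) : IsIsotropic t (act U g) := by
  rintro _ ⟨x, hx, rfl⟩ _ ⟨y, hy, rfl⟩
  exact (form_vecMul hg x y).trans (hU x hx y hy)

theorem vec_eq_toRat (a b : ℤ) : vec a b = toRat ![0, a, 0, b] := by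
  rw [toRat_cons]; simp [vec]

theorem v0_eq_toRat : v0 = toRat ![1, 0, 0, 0] := by
  rw [toRat_cons]; simp [v0]

theorem v0_mem_plane (t : ℕ) (a b : ℤ) : v0 ∈ (plane t a b).1 :=
  Submodule.subset_span (by simp)

theorem vec_mem_plane (t : ℕ) (a b : ℤ) : vec a b ∈ (plane t a b).1 :=
  Submodule.subset_span (by simp)

theorem finrank_plane (t : ℕ) {a b : ℤ} (hab : (a, b) ≠ (0, 0)) :
    Module.finrank ℚ (plane t a b).1 = 2 := by
  have hli : LinearIndependent ℚ ![v0, vec a b] := by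
    rw [LinearIndependent.pair_iff]
    intro c d h
    have h0 := congrFun h 0
    have h1 := congrFun h 1
    have h3 := congrFun h 3
    simp [v0, vec] at h0 h1 h3
    refine ⟨h0, ?_⟩
    by_contra hd
    apply hab
    simp [h1.resolve_left hd, h3.resolve_left hd]
  have := finrank_span_eq_card hli
  rw [Matrix.range_cons, Matrix.range_cons, Matrix.range_empty, Set.union_empty,
    Set.singleton_union] at this
  exact this.trans (by simp)

theorem eq_plane_of_mem {t : ℕ} {W : Submodule ℚ (Fin 4 → ℚ)} (hW : Module.finrank ℚ W = 2)
    {a b : ℤ} (hab : (a, b) ≠ (0, 0)) (h0 : v0 ∈ W) (h : vec a b ∈ W) :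
    W = (plane t a b).1 := by
  symm
  apply Submodule.eq_of_le_of_finrank_eq
  · refine Submodule.span_le.2 ?_
    rintro _ (rfl | rfl)
    · exact h0
    · exact h
  · rw [finrank_plane t hab, hW]

theorem pair_ne_zero_of_isCoprime {a b : ℤ} (h : IsCoprime a b) : (a, b) ≠ (0, 0) := by
  rintro h'
  simp only [Prod.mk.injEq] at h'
  rw [h'.1, h'.2] at h
  exact not_isCoprime_zero_zero h

/-- As `a`, `b` are coprime, `v₀` and `(0, a, 0, b)` generate the lattice of integer vectors of the
plane that they span. -/
theorem exists_of_toRat_mem_plane {t : ℕ} {a b : ℤ} (hab : IsCoprime a b) {x : Fin 4 → ℤ}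
    (hx : toRat x ∈ (plane t a b).1) : ∃ m n : ℤ, x = ![m, n * a, 0, n * b] := by
  obtain ⟨α, β, h⟩ := hab
  obtain ⟨c, d, hcd⟩ := Submodule.mem_span_pair.1 hx
  have h' := congrArg (Int.cast : ℤ → ℚ) h
  push_cast at h'
  have h1 := congrFun hcd 1
  have h2 := congrFun hcd 2
  have h3 := congrFun hcd 3
  simp [v0, vec, toRat] at h1 h2 h3
  have hd : d = ((α * x 1 + β * x 3 : ℤ) : ℚ) := by
    push_cast
    linear_combination α * h1 + β * h3 - d * h'
  rw [hd] at h1 h3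
  refine ⟨x 0, α * x 1 + β * x 3, ?_⟩
  ext i
  fin_cases i
  · rfl
  · exact_mod_cast h1.symm
  · exact (by exact_mod_cast h2.symm : x 2 = 0)
  · exact_mod_cast h3.symm

theorem toRat_mem_plane (t : ℕ) (a b m n : ℤ) : toRat ![m, n * a, 0, n * b] ∈ (plane t a b).1 := by
  refine Submodule.mem_span_pair.2 ⟨m, n, ?_⟩
  rw [toRat_cons]
  ext i
  fin_cases i <;> simp [v0, vec]

/-- An isotropic plane that contains a primitive integer vector `x` with `gcd(t, x₀, x₂) = 1` is
equivalent to a plane spanned by `v₀` and a vector `(0, a, 0, b)` with `a`, `b` coprime. -/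
theorem exists_act_eq_plane {t : ℕ} {U : Submodule ℚ (Fin 4 → ℚ)}
    (hU : IsIsotropic t U) (hU2 : Module.finrank ℚ U = 2) {x : Fin 4 → ℤ} (hx : Primitive x)
    (hxU : toRat x ∈ U) (hgcd : Nat.gcd t (Int.gcd (x 0) (x 2)) = 1) :
    ∃ g ∈ Gamma t, x ᵥ* (g : Matrix (Fin 4) (Fin 4) ℤ) = ![1, 0, 0, 0] ∧
      ∃ a b : ℤ, IsCoprime a b ∧ act U g = (plane t a b).1 := by
  obtain ⟨g, hg, hgx⟩ := vecEquiv_normalForm (a := 0) (b := 0) hx hgcd (by simp) (by simp)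
  simp only [Nat.cast_one] at hgx
  refine ⟨g, hg, hgx, ?_⟩
  have hv0 : v0 ∈ act U g := by
    rw [v0_eq_toRat, ← hgx]
    exact toRat_vecMul_mem_act hxU g
  have hW2 : Module.finrank ℚ (act U g) = 2 := by rw [finrank_act, hU2]
  obtain ⟨w, hw, hw'⟩ : ∃ w ∈ act U g, w ∉ Submodule.span ℚ {v0} := by
    by_contra! hcon
    have h1 := Submodule.finrank_mono (show act U g ≤ Submodule.span ℚ {v0} from hcon)
    rw [hW2, finrank_span_singleton v0_ne_zero] at h1
    omega
  have hw2 : w 2 = 0 := by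
    have := isIsotropic_act hg hU v0 hv0 w hw
    simpa [form_eq, v0] using this
  have hw0 : w - w 0 • v0 ≠ 0 := by
    intro h
    exact hw' (Submodule.mem_span_singleton.2 ⟨w 0, (sub_eq_zero.1 h).symm⟩)
  have hwW : w - w 0 • v0 ∈ act U g := sub_mem hw ((act U g).smul_mem _ hv0)
  obtain ⟨c, y, hc, hy, hyW, hcy⟩ := exists_primitive_mem hwW hw0
  have hy0 : y 0 = 0 := by
    have := congrFun hcy 0
    simpa [v0, toRat, hc] using this
  have hy2 : y 2 = 0 := by
    have := congrFun hcy 2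
    simpa [v0, toRat, hc, hw2] using this
  have hcop : IsCoprime (y 1) (y 3) := by
    obtain ⟨z, hz⟩ := hy.exists_dotProduct
    refine ⟨z 1, z 3, ?_⟩
    simp only [dotProduct, Fin.sum_univ_four, hy0, hy2] at hz
    linear_combination hz
  refine ⟨y 1, y 3, hcop, eq_plane_of_mem hW2 (pair_ne_zero_of_isCoprime hcop) hv0 ?_⟩
  convert hyW using 1
  rw [vec_eq_toRat]
  congr 1
  ext i
  fin_cases i <;> simp [hy0, hy2]

/-- In an isotropic plane, not all integer vectors have both `x₀` and `x₂` divisible by a prime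
`p` that divides `t` exactly once. -/
theorem exists_not_dvd {t : ℕ} {U : Submodule ℚ (Fin 4 → ℚ)}
    (hU : IsIsotropic t U) (hU2 : Module.finrank ℚ U = 2) {p : ℕ} (hp : p.Prime)
    (hpt : ¬ p * p ∣ t) :
    ∃ x : Fin 4 → ℤ, toRat x ∈ U ∧ ¬ ((p : ℤ) ∣ x 0 ∧ (p : ℤ) ∣ x 2) := by
  by_contra! hcon
  have hpp : Prime (p : ℤ) := Nat.prime_iff_prime_int.1 hp
  have hpt' : ¬ (p * p : ℤ) ∣ t := by exact_mod_cast hpt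
  have hform : ∀ x y : Fin 4 → ℤ, toRat x ∈ U → toRat y ∈ U →
      x 0 * y 2 + t * (x 1 * y 3) - x 2 * y 0 - t * (x 3 * y 1) = 0 := by
    intro x y hx hy
    have := hU _ hx _ hy
    rw [form_eq] at this
    simp only [toRat] at this
    exact_mod_cast this
  have hnot : ∀ x : Fin 4 → ℤ, Primitive x → toRat x ∈ U → ¬ ((p : ℤ) ∣ x 1 ∧ (p : ℤ) ∣ x 3) := by
    rintro x hx hxU ⟨h1, h3⟩
    obtain ⟨h0, h2⟩ : (p : ℤ) ∣ x 0 ∧ (p : ℤ) ∣ x 2 := hcon x hxU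
    refine hpp.not_isUnit (hx p fun i => ?_)
    fin_cases i <;> assumption
  have : Nontrivial U := Module.nontrivial_of_finrank_pos (R := ℚ) (by omega)
  obtain ⟨v, hv⟩ := exists_ne (0 : U)
  obtain ⟨-, x, -, hx, hxU, -⟩ := exists_primitive_mem v.2 (fun h => hv (Subtype.ext h))
  obtain ⟨w, hwU, hw⟩ : ∃ w ∈ U, w ∉ Submodule.span ℚ {toRat x} := by
    by_contra! hcon
    have h1 := Submodule.finrank_mono (show U ≤ Submodule.span ℚ {toRat x} from hcon)
    rw [hU2, finrank_span_singleton (toRat_ne_zero hx.ne_zero)] at h1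
    omega
  -- Eliminating a coordinate with `x` gives a primitive vector `y` with `y i = 0`.
  have helim : ∀ i, x i ≠ 0 → ∃ y : Fin 4 → ℤ, Primitive y ∧ toRat y ∈ U ∧ y i = 0 := by
    intro i hi
    have hi' : (x i : ℚ) ≠ 0 := by exact_mod_cast hi
    have hne : w - (w i / x i) • toRat x ≠ 0 := fun h =>
      hw (Submodule.mem_span_singleton.2 ⟨_, (sub_eq_zero.1 h).symm⟩)
    obtain ⟨c, y, hc, hy, hyU, hyc⟩ := exists_primitive_mem (sub_mem hwU (U.smul_mem _ hxU)) hne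
    refine ⟨y, hy, hyU, ?_⟩
    have := congrFun hyc i
    simpa [toRat, hc, hi'] using this
  -- If `p` divides `x₀, x₂, y₀, y₂`, then isotropy gives `p² ∣ t (x₁ y₃ - x₃ y₁)`.
  have hsq : ∀ y : Fin 4 → ℤ, toRat y ∈ U → (p : ℤ) ∣ x 1 * y 3 - x 3 * y 1 := by
    intro y hyU
    obtain ⟨a, ha⟩ := (hcon x hxU).1
    obtain ⟨b, hb⟩ := (hcon x hxU).2
    obtain ⟨c, hc⟩ := (hcon y hyU).1
    obtain ⟨d, hd⟩ := (hcon y hyU).2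
    have h := hform x y hxU hyU
    rw [ha, hb, hc, hd] at h
    have h2 : (p * p : ℤ) ∣ t * (x 1 * y 3 - x 3 * y 1) :=
      ⟨b * c - a * d, by linear_combination h⟩
    by_contra hnd
    have hcop : IsCoprime (p * p : ℤ) (x 1 * y 3 - x 3 * y 1) := by
      have := (hpp.coprime_iff_not_dvd).2 hnd
      exact this.mul_left this
    exact hpt' (hcop.dvd_of_dvd_mul_right h2)
  by_cases h1 : (p : ℤ) ∣ x 1
  · have h3 : ¬ (p : ℤ) ∣ x 3 := fun h3 => hnot x hx hxU ⟨h1, h3⟩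
    obtain ⟨y, hy, hyU, hy0⟩ := helim 3 (fun h => h3 (h ▸ dvd_zero _))
    have := hsq y hyU
    rw [hy0, mul_zero, zero_sub, dvd_neg] at this
    exact hnot y hy hyU ⟨(hpp.dvd_or_dvd this).resolve_left h3, hy0 ▸ dvd_zero _⟩
  · obtain ⟨y, hy, hyU, hy0⟩ := helim 1 (fun h => h1 (h ▸ dvd_zero _))
    have := hsq y hyU
    rw [hy0, mul_zero, sub_zero] at this
    exact hnot y hy hyU ⟨hy0 ▸ dvd_zero _, (hpp.dvd_or_dvd this).resolve_left h1⟩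

/-- The vectors of `exists_not_dvd` for the various primes are combined into one that works for
all the prime divisors of the squarefree number `t`. -/
theorem exists_gcd_eq_one {t : ℕ} (ht : Squarefree t) {U : Submodule ℚ (Fin 4 → ℚ)}
    (hU : IsIsotropic t U) (hU2 : Module.finrank ℚ U = 2) :
    ∃ x : Fin 4 → ℤ, Primitive x ∧ toRat x ∈ U ∧ Nat.gcd t (Int.gcd (x 0) (x 2)) = 1 := by
  obtain ⟨x, hx0, hxU, hx⟩ : ∃ x : Fin 4 → ℤ, x ≠ 0 ∧ toRat x ∈ U ∧
      ∀ p ∈ t.primeFactors, ¬ ((p : ℤ) ∣ x 0 ∧ (p : ℤ) ∣ x 2) := by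
    suffices ∀ s : Finset ℕ, (∀ p ∈ s, p.Prime) → ∃ x : Fin 4 → ℤ, x ≠ 0 ∧ toRat x ∈ U ∧
        ∀ p ∈ s, ¬ ((p : ℤ) ∣ x 0 ∧ (p : ℤ) ∣ x 2) from
      this _ fun p hp => Nat.prime_of_mem_primeFactors hp
    intro s
    induction s using Finset.induction_on with
    | empty =>
      intro _
      have : Nontrivial U := Module.nontrivial_of_finrank_pos (R := ℚ) (by omega)
      obtain ⟨v, hv⟩ := exists_ne (0 : U)
      obtain ⟨-, x, -, hx, hxU, -⟩ := exists_primitive_mem v.2 (fun h => hv (Subtype.ext h))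
      exact ⟨x, hx.ne_zero, hxU, by simp⟩
    | insert p s hps ih =>
      intro hs
      obtain ⟨x, hx0, hxU, hx⟩ := ih fun q hq => hs q (Finset.mem_insert_of_mem hq)
      have hp := hs p (Finset.mem_insert_self _ _)
      have hpp : Prime (p : ℤ) := Nat.prime_iff_prime_int.1 hp
      by_cases hpx : (p : ℤ) ∣ x 0 ∧ (p : ℤ) ∣ x 2
      · obtain ⟨y, hyU, hy⟩ := exists_not_dvd hU hU2 hp
          (fun h => hp.one_lt.ne' (Nat.isUnit_iff.1 (ht p h)))
        -- Adding a multiple of `∏ q ∈ s, q` does not change the residues modulo the `q ∈ s`.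
        set P : ℤ := ((∏ q ∈ s, q : ℕ) : ℤ)
        have hgood : ∀ q ∈ insert p s, ¬ ((q : ℤ) ∣ (x + P • y) 0 ∧ (q : ℤ) ∣ (x + P • y) 2) := by
          intro q hq
          simp only [Pi.add_apply, Pi.smul_apply, smul_eq_mul]
          rcases Finset.mem_insert.1 hq with rfl | hq
          · rw [dvd_add_right hpx.1, dvd_add_right hpx.2]
            have hP : ¬ (q : ℤ) ∣ P := by
              rw [Int.natCast_dvd_natCast, hp.prime.dvd_finsetProd_iff]
              rintro ⟨q', hq', hd⟩
              have := (Nat.prime_dvd_prime_iff_eq hp (hs q' (Finset.mem_insert_of_mem hq'))).1 hd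
              exact hps (this ▸ hq')
            rintro ⟨h0, h2⟩
            exact hy ⟨(hpp.dvd_or_dvd h0).resolve_left hP, (hpp.dvd_or_dvd h2).resolve_left hP⟩
          · have hP : (q : ℤ) ∣ P := Int.natCast_dvd_natCast.2 (Finset.dvd_prod_of_mem _ hq)
            rw [dvd_add_left (hP.mul_right _), dvd_add_left (hP.mul_right _)]
            exact hx q hq
        refine ⟨x + P • y, ?_, ?_, hgood⟩
        · intro h
          exact hgood p (Finset.mem_insert_self _ _) (by rw [h]; simp)
        · rw [toRat_add, toRat_smul]
          exact add_mem hxU (U.smul_mem _ hyU)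
      · refine ⟨x, hx0, hxU, fun q hq => ?_⟩
        rcases Finset.mem_insert.1 hq with rfl | hq
        · exact hpx
        · exact hx q hq
  obtain ⟨d, y, hd, hy, rfl⟩ := exists_primitive_of_int hx0
  have hd' : (d : ℚ) ≠ 0 := by exact_mod_cast hd
  refine ⟨y, hy, ?_, ?_⟩
  · have := U.smul_mem (d : ℚ)⁻¹ hxU
    rwa [toRat_smul, smul_smul, inv_mul_cancel₀ hd', one_smul] at this
  · by_contra hne
    obtain ⟨p, hp, hpd⟩ := Nat.exists_prime_and_dvd hne
    have h1 : (p : ℤ) ∣ (Int.gcd (y 0) (y 2) : ℕ) := by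
      exact_mod_cast hpd.trans (Nat.gcd_dvd_right _ _)
    exact hx p (Nat.mem_primeFactors.2 ⟨hp, hpd.trans (Nat.gcd_dvd_left _ _), ht.ne_zero⟩)
      ⟨(h1.trans (Int.gcd_dvd_left _ _)).mul_left d,
        (h1.trans (Int.gcd_dvd_right _ _)).mul_left d⟩

/-! ### Plane vertices and `𝒪(t)` -/

/-- Every element of `𝒩(n)` is the residue of a pair of coprime integers. -/
theorem exists_coprime_lift {n : ℕ} (hn : n ≠ 0) {a b : ℤ} (h : residue n a b ∈ NN n) :
    ∃ a' b' : ℤ, IsCoprime a' b' ∧ residue n a' b' = residue n a b := by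
  obtain ⟨α, β, γ, hb⟩ := exists_bezout_of_mem_NN hn h
  -- After a change of basis `(a, b)` becomes `(d, 0)`, which lifts to `(d, n)`.
  obtain ⟨p, q, r, s, hdet, h1, h2⟩ := exists_SL2_row_reduce a b
  set d : ℤ := (Int.gcd a b : ℤ)
  have ha : a = d * s := by linear_combination s * h1 - a * hdet - r * h2
  have hb' : b = -(d * q) := by linear_combination p * h2 - q * h1 - b * hdet
  refine ⟨d * s - n * r, -(d * q) + n * p, ?_, ?_⟩
  · refine ⟨p * (β * s - γ * q) + q * α, r * (β * s - γ * q) + s * α, ?_⟩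
    rw [ha, hb'] at hb
    linear_combination hb + (d * (β * s - γ * q) + n * α) * hdet
  · rw [residue_eq_iff, ha, hb']
    exact ⟨⟨-r, by ring⟩, ⟨p, by ring⟩⟩

/-- The principal congruence subgroup of level `t` in `SL(2, ℤ)`, acting on the second and fourth
coordinates, is transitive on the coprime pairs in a given residue class. -/
theorem exists_mem_Gamma_of_residue_eq {t : ℕ} {a b a' b' : ℤ}
    (h : IsCoprime a b) (h' : IsCoprime a' b') (hres : residue t a b = residue t a' b') :
    ∃ g ∈ Gamma t, ![1, 0, 0, 0] ᵥ* (g : Matrix (Fin 4) (Fin 4) ℤ) = ![1, 0, 0, 0] ∧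
      ![0, a, 0, b] ᵥ* (g : Matrix (Fin 4) (Fin 4) ℤ) = ![0, a', 0, b'] := by
  obtain ⟨⟨x, hx⟩, ⟨y, hy⟩⟩ := residue_eq_iff.1 hres.symm
  obtain ⟨α, β, hαβ⟩ := h
  obtain ⟨α', β', hαβ'⟩ := h'
  -- The matrix is `1 + t N` with `(a, b) N = (x, y)`; the remaining freedom is the choice of
  -- `z`, `w`, for which `det (1 + t N) = 1`.
  set c := α * x + β * y
  set w := -(c * α') with hw
  set z := c * β' with hz
  set A := 1 + t * (α * x - b * z) with hA
  set B := t * (α * y - b * w) with hB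
  set C := t * (β * x + a * z) with hC
  set D := 1 + t * (β * y + a * w) with hD
  have hdet : A * D - B * C = 1 := by
    have e : c - b * z + a * w + t * (x * w - y * z) = 0 := by
      rw [hw, hz]
      linear_combination (-c) * hαβ' + (c * α') * hx + (c * β') * hy
    rw [hA, hB, hC, hD]
    linear_combination t * e + t ^ 2 * (x * w - y * z) * hαβ
  obtain ⟨g, hg, hgM⟩ := exists_mem_Gamma_of_matrix (t := t)
    !![1, 0, 0, 0; 0, A, 0, B; 0, 0, 1, 0; 0, C, 0, D]
    !![1, 0, 0, 0; 0, D, 0, -B; 0, 0, 1, 0; 0, -C, 0, A]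
    (by
      clear_value A B C D
      ext i j
      fin_cases i <;> fin_cases j <;> simp [Matrix.mul_apply, Fin.sum_univ_four] <;>
        first | linear_combination hdet | ring1)
    (by
      clear_value A B C D
      ext i j
      fin_cases i <;> fin_cases j <;> simp [Matrix.mul_apply, Fin.sum_univ_four, Lam] <;>
        first | linear_combination t * hdet | linear_combination -t * hdet | ring1)
    (by intro j; fin_cases j <;> simp [Matrix.one_apply, hA, hB])
    (by intro j; fin_cases j <;> simp [Matrix.one_apply, hC, hD])
  refine ⟨g, hg, ?_, ?_⟩
  · rw [hgM]
    ext i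
    fin_cases i <;> simp [vecMul, dotProduct, Fin.sum_univ_four]
  · rw [hgM]
    ext i
    fin_cases i
    · simp [vecMul, dotProduct, Fin.sum_univ_four]
    · simp [vecMul, dotProduct, Fin.sum_univ_four]
      rw [hA, hC]
      linear_combination t * x * hαβ - hx
    · simp [vecMul, dotProduct, Fin.sum_univ_four]
    · simp [vecMul, dotProduct, Fin.sum_univ_four]
      rw [hB, hD]
      linear_combination t * y * hαβ - hy

theorem vertexOf_plane_eq_of_residue_eq {t : ℕ} {a b a' b' : ℤ}
    (h : IsCoprime a b) (h' : IsCoprime a' b') (hres : residue t a b = residue t a' b') :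
    vertexOf (plane t a b) = vertexOf (plane t a' b') := by
  obtain ⟨g, hg, h1, h2⟩ := exists_mem_Gamma_of_residue_eq h h' hres
  rw [vertexOf_eq_iff]
  refine ⟨g, hg, eq_plane_of_mem ?_ (pair_ne_zero_of_isCoprime h') ?_ ?_⟩
  · rw [finrank_act, finrank_plane t (pair_ne_zero_of_isCoprime h)]
  · rw [v0_eq_toRat, ← h1]
    exact toRat_vecMul_mem_act (v0_eq_toRat ▸ v0_mem_plane t a b) g
  · rw [vec_eq_toRat, ← h2]
    exact toRat_vecMul_mem_act (vec_eq_toRat a b ▸ vec_mem_plane t a b) g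

/-- If `m` is prime to `t`, the plane spanned by `v₀` and `(0, a, 0, b)` is equivalent to one
spanned by `v₀` and `(0, A, 0, B)` with `m (A, B)` congruent to `(a, b)` modulo `t`. -/
theorem exists_vertexOf_plane_eq {t : ℕ} (ht : t ≠ 0) {a b m : ℤ} (h : IsCoprime a b)
    (hm : IsCoprime m t) :
    ∃ A B : ℤ, IsCoprime A B ∧ residue t (m * A) (m * B) = residue t a b ∧
      vertexOf (plane t a b) = vertexOf (plane t A B) := by
  obtain ⟨α, β, hαβ⟩ := h
  obtain ⟨l, k, hlk⟩ := hm
  have h : IsCoprime a b := ⟨α, β, hαβ⟩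
  -- `x` and `y` form a basis of the lattice of integer vectors of the plane.
  set x : Fin 4 → ℤ := ![m, t * a, 0, t * b] with hx
  set y : Fin 4 → ℤ := ![-k, l * a, 0, l * b] with hy
  have hxp : Primitive x := by
    apply primitive_of_dotProduct (y := ![l, k * α, 0, k * β])
    simp [hx, dotProduct, Fin.sum_univ_four]
    linear_combination hlk + k * t * hαβ
  have hxU : toRat x ∈ (plane t a b).1 := toRat_mem_plane t a b m t
  have hyU : toRat y ∈ (plane t a b).1 := toRat_mem_plane t a b (-k) l
  have hgcd : Nat.gcd t (Int.gcd (x 0) (x 2)) = 1 := by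
    have : Int.gcd m t = 1 := Int.isCoprime_iff_gcd_eq_one.1 ⟨l, k, hlk⟩
    rw [Nat.gcd_comm]
    simpa [hx, Int.gcd_def] using this
  obtain ⟨g, hg, hgx, A, B, hAB, hact⟩ := exists_act_eq_plane (plane t a b).2.2
    (finrank_plane t (pair_ne_zero_of_isCoprime h)) hxp hxU hgcd
  obtain ⟨k', n, hn⟩ := exists_of_toRat_mem_plane hAB (hact ▸ toRat_vecMul_mem_act hyU g)
  -- The vector `(0, a, 0, b) = m y + k x` is fixed modulo `t` and goes to `m (y g)` modulo `v₀`.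
  have hf : ![0, a, 0, b] = m • y + k • x := by
    ext i
    fin_cases i <;> simp [hx, hy]
    · ring
    · linear_combination -a * hlk
    · linear_combination -b * hlk
  have hfg : VecEquiv t ![0, a, 0, b] ![m * k' + k, m * (n * A), 0, m * (n * B)] := by
    refine ⟨g, hg, ?_⟩
    rw [hf, add_vecMul, smul_vecMul, smul_vecMul, hgx, hn]
    ext i
    fin_cases i <;> simp
  have hdvd := hfg.dvd ht (dvd_refl _) (by simp) (by simp)
  -- `n` divides `y - k' x`, which is primitive because `x`, `y` form a lattice basis.
  have hnu : IsUnit n := by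
    have hz : y - k' • x = n • (![0, A, 0, B] ᵥ*
        ((g⁻¹ : GL (Fin 4) ℤ) : Matrix (Fin 4) (Fin 4) ℤ)) := by
      have hyx : (y - k' • x) ᵥ* (g : Matrix (Fin 4) (Fin 4) ℤ) = n • ![0, A, 0, B] := by
        rw [sub_vecMul, smul_vecMul, hgx, hn]
        ext i
        fin_cases i <;> simp
      rw [← smul_vecMul, ← hyx, vecMul_vecMul, ← Units.val_mul, mul_inv_cancel, Units.val_one,
        vecMul_one]
    have hdiv : ∀ i, n ∣ (y - k' • x) i := fun i => by
      rw [hz]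
      exact Dvd.intro _ rfl
    obtain ⟨c0, h0⟩ := hdiv 0
    obtain ⟨c1, h1⟩ := hdiv 1
    obtain ⟨c3, h3⟩ := hdiv 3
    simp [hx, hy] at h0 h1 h3
    refine isUnit_of_dvd_one ⟨m * (α * c1 + β * c3) - t * c0, ?_⟩
    linear_combination (-1) * hlk + m * (α * h1 + β * h3) - t * h0 - m * (l - k' * t) * hαβ
  have hcop : IsCoprime (n * A) (n * B) :=
    (isCoprime_mul_unit_left hnu A B).2 hAB
  refine ⟨n * A, n * B, hcop, ?_, ?_⟩
  · rw [residue_eq_iff]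
    simpa using ⟨hdvd.2.1, hdvd.2.2.2⟩
  · rw [vertexOf_eq_iff]
    refine ⟨g, hg, eq_plane_of_mem ?_ (pair_ne_zero_of_isCoprime hcop) ?_ ?_⟩
    · rw [finrank_act, finrank_plane t (pair_ne_zero_of_isCoprime h)]
    · rw [hact]
      exact v0_mem_plane t A B
    · rw [hact, vec_eq_toRat]
      exact toRat_mem_plane t A B 0 n

theorem smul_residue {n : ℕ} (c a b : ℤ) :
    (c : ZMod n) • residue n a b = residue n (c * a) (c * b) := by
  simp [residue]

theorem isUnit_of_residue_mem_NN {n : ℕ} (hn : n ≠ 0) {c a b : ℤ}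
    (h : residue n (c * a) (c * b) ∈ NN n) : IsUnit (c : ZMod n) := by
  obtain ⟨α, β, γ, h⟩ := exists_bezout_of_mem_NN hn h
  have h' := congrArg (Int.cast : ℤ → ZMod n) h
  push_cast at h'
  rw [ZMod.natCast_self] at h'
  exact IsUnit.of_mul_eq_one (β * a + γ * b : ZMod n) (by linear_combination h')

theorem residue_mem_NN_of_isCoprime (n : ℕ) {a b : ℤ} (h : IsCoprime a b) :
    residue n a b ∈ NN n := by
  obtain ⟨α, β, h⟩ := h
  exact residue_mem_NN_of_bezout (α := 0) (β := α) (γ := β) (by linear_combination h)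

theorem OO.mk_eq_mk {n : ℕ} {p q : NN n} :
    OO.mk p = OO.mk q ↔ ∃ u : (ZMod n)ˣ, (u : ZMod n) • p.1 = q.1 :=
  Quotient.eq (r := unitSetoid n)

theorem OO.mk_eq_mk_of_residue {n : ℕ} {c a b : ℤ} {p q : NN n} (hn : n ≠ 0)
    (hp : residue n a b = p.1) (hq : residue n (c * a) (c * b) = q.1) : OO.mk p = OO.mk q := by
  have hu : IsUnit (c : ZMod n) := isUnit_of_residue_mem_NN hn (hq ▸ q.2)
  rw [OO.mk_eq_mk]
  exact ⟨hu.unit, by rw [IsUnit.unit_spec, ← hp, ← hq, smul_residue]⟩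

/-- Two planes with coprime parameters are equivalent precisely when the parameters have the same
class in `𝒪(t)`. One direction holds because an equivalence `g` fixes `(0, a, 0, b)` modulo `t`;
for the other, `exists_vertexOf_plane_eq` realizes multiplication by a unit. -/
theorem vertexOf_plane_eq_iff {t : ℕ} (ht : t ≠ 0) {a b a' b' : ℤ} (h : IsCoprime a b)
    (h' : IsCoprime a' b') :
    vertexOf (plane t a b) = vertexOf (plane t a' b') ↔
      OO.mk ⟨residue t a b, residue_mem_NN_of_isCoprime t h⟩ =
        OO.mk ⟨residue t a' b', residue_mem_NN_of_isCoprime t h'⟩ := by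
  constructor
  · intro he
    obtain ⟨g, hg, hact⟩ := vertexOf_eq_iff.1 he
    obtain ⟨m, n, hmn⟩ := exists_of_toRat_mem_plane h'
      (hact ▸ toRat_vecMul_mem_act (vec_eq_toRat a b ▸ vec_mem_plane t a b) g)
    have := VecEquiv.dvd ht (x := ![0, a, 0, b]) ⟨g, hg, hmn⟩ (dvd_refl _) (by simp) (by simp)
    refine (OO.mk_eq_mk_of_residue (c := n) (a := a') (b := b') ht rfl
      (residue_eq_iff.2 ?_)).symm
    simpa using ⟨this.2.1, this.2.2.2⟩
  · intro he
    obtain ⟨u, hu⟩ := OO.mk_eq_mk.1 he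
    obtain ⟨m, hm⟩ := ZMod.intCast_surjective ((u⁻¹ : (ZMod t)ˣ) : ZMod t)
    have hmu : IsUnit (m : ZMod t) := hm ▸ Units.isUnit _
    obtain ⟨A, B, hAB, hres, hv⟩ := exists_vertexOf_plane_eq ht h
      ((ZMod.coe_int_isUnit_iff_isCoprime m t).1 hmu).symm
    rw [hv]
    refine vertexOf_plane_eq_of_residue_eq hAB h' ?_
    change (u : ZMod t) • residue t a b = residue t a' b' at hu
    rw [← hu, ← hres, ← smul_residue, smul_smul, hm, Units.mul_inv, one_smul]

theorem exists_isCoprime_rep {n : ℕ} (hn : n ≠ 0) (p : NN n) :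
    ∃ ab : ℤ × ℤ, IsCoprime ab.1 ab.2 ∧ residue n ab.1 ab.2 = p.1 := by
  obtain ⟨a, b, hab, h⟩ := exists_coprime_lift hn
    (show residue n (p.1.1.cast : ℤ) (p.1.2.cast : ℤ) ∈ NN n by rw [residue_cast]; exact p.2)
  exact ⟨(a, b), hab, by rw [h, residue_cast]⟩

/-- The plane vertex attached to a class in `𝒪(t)`, computed from representatives that are
coprime integers. -/
noncomputable def planeVertex {t : ℕ} (ht : t ≠ 0) (w : OO t) : Vertex t :=
  Quotient.lift (s := unitSetoid t)
    (fun p : NN t => vertexOf (plane t (exists_isCoprime_rep ht p).choose.1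
      (exists_isCoprime_rep ht p).choose.2))
    (fun p q h => by
      have hp := (exists_isCoprime_rep ht p).choose_spec
      have hq := (exists_isCoprime_rep ht q).choose_spec
      refine (vertexOf_plane_eq_iff ht hp.1 hq.1).2 ?_
      have e : OO.mk p = OO.mk q := Quotient.sound (s := unitSetoid t) h
      exact (congrArg OO.mk (Subtype.ext hp.2)).trans
        (e.trans (congrArg OO.mk (Subtype.ext hq.2.symm)))) w

theorem planeVertex_mk_of_isCoprime {t : ℕ} (ht : t ≠ 0) {a b : ℤ} (h : IsCoprime a b)
    (hab : residue t a b ∈ NN t) :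
    planeVertex ht (OO.mk ⟨residue t a b, hab⟩) = vertexOf (plane t a b) := by
  have hp := (exists_isCoprime_rep ht ⟨residue t a b, hab⟩).choose_spec
  exact vertexOf_plane_eq_of_residue_eq hp.1 h hp.2

theorem planeVertex_mk {t : ℕ} (ht : t ≠ 0) (a b : ℤ) (hab : residue t a b ∈ NN t)
    (hne : (a, b) ≠ (0, 0)) :
    planeVertex ht (OO.mk ⟨residue t a b, hab⟩) = vertexOf (plane t a b) := by
  obtain ⟨a', ha⟩ := Int.gcd_dvd_left a b
  obtain ⟨b', hb⟩ := Int.gcd_dvd_right a b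
  have hbez := Int.gcd_eq_gcd_ab a b
  have hd : (Int.gcd a b : ℤ) ≠ 0 := by
    intro h
    apply hne
    rw [h, zero_mul] at ha hb
    rw [ha, hb]
  set d : ℤ := (Int.gcd a b : ℤ)
  have hcop : IsCoprime a' b' := by
    refine ⟨a.gcdA b, a.gcdB b, mul_left_cancel₀ hd ?_⟩
    linear_combination -(a.gcdA b) * ha - (a.gcdB b) * hb - hbez
  have hplane : (plane t a' b').1 = (plane t a b).1 := by
    refine eq_plane_of_mem (finrank_plane t (pair_ne_zero_of_isCoprime hcop)) hne
      (v0_mem_plane t a' b') ?_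
    rw [vec_eq_toRat, ha, hb]
    exact toRat_mem_plane t a' b' 0 d
  rw [← vertexOf_eq_of_val_eq hplane,
    ← planeVertex_mk_of_isCoprime ht hcop (residue_mem_NN_of_isCoprime t hcop)]
  refine congrArg _ (OO.mk_eq_mk_of_residue (c := d) ht rfl ?_).symm
  rw [← ha, ← hb]

theorem OO.exists_rep {t : ℕ} (ht : t ≠ 0) (w : OO t) :
    ∃ (a b : ℤ) (h : IsCoprime a b),
      w = OO.mk ⟨residue t a b, residue_mem_NN_of_isCoprime t h⟩ := by
  induction w using Quotient.inductionOn with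
  | h p =>
    obtain ⟨ab, h, hp⟩ := exists_isCoprime_rep ht p
    exact ⟨ab.1, ab.2, h, congrArg OO.mk (Subtype.ext hp.symm)⟩

theorem planeVertex_injective {t : ℕ} (ht : t ≠ 0) : Function.Injective (planeVertex ht) := by
  intro w w' he
  obtain ⟨a, b, h, rfl⟩ := w.exists_rep ht
  obtain ⟨a', b', h', rfl⟩ := w'.exists_rep ht
  rw [planeVertex_mk_of_isCoprime ht h, planeVertex_mk_of_isCoprime ht h'] at he
  exact (vertexOf_plane_eq_iff ht h h').1 he

theorem range_planeVertex {t : ℕ} (ht : Squarefree t) :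
    Set.range (planeVertex ht.ne_zero) = {x | IsPlaneVertex x} := by
  apply Set.Subset.antisymm
  · rintro _ ⟨w, rfl⟩
    obtain ⟨a, b, h, rfl⟩ := w.exists_rep ht.ne_zero
    rw [planeVertex_mk_of_isCoprime _ h, Set.mem_ofPred_eq, isPlaneVertex_vertexOf]
    exact finrank_plane t (pair_ne_zero_of_isCoprime h)
  · rintro _ ⟨U, rfl, hU⟩
    obtain ⟨x, hx, hxU, hgcd⟩ := exists_gcd_eq_one ht U.2.2 hU
    obtain ⟨g, hg, -, a, b, h, hact⟩ := exists_act_eq_plane U.2.2 hU hx hxU hgcd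
    refine ⟨OO.mk ⟨_, residue_mem_NN_of_isCoprime t h⟩, ?_⟩
    rw [planeVertex_mk_of_isCoprime _ h]
    exact (vertexOf_eq_iff.2 ⟨g, hg, hact⟩).symm

/-! ### Edges -/

theorem adj_planeVertex_line0 {t : ℕ} (ht : t ≠ 0) (w : OO t) :
    (building t).Adj (planeVertex ht w) (vertexOf (line0 t)) := by
  obtain ⟨a, b, h, rfl⟩ := w.exists_rep ht
  rw [planeVertex_mk_of_isCoprime ht h, SimpleGraph.adj_comm, building_adj_iff_exists
    (finrank_span_singleton v0_ne_zero) (finrank_plane t (pair_ne_zero_of_isCoprime h))]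
  refine ⟨1, one_mem _, ?_⟩
  rw [act_one]
  exact (Submodule.span_singleton_le_iff_mem _ _).2 (v0_mem_plane t a b)

theorem adj_lineVertex_planeVertex_iff {t : ℕ} (ht : t ≠ 0)
    (i : Σ r : {r : ℕ // r ∣ t}, MM r.1) (w : OO t) :
    (building t).Adj (lineVertex ht i) (planeVertex ht w) ↔
      i.2.toOO = w.reduce ht i.1.2 := by
  obtain ⟨r, m⟩ := i
  have hr0 := ne_zero_of_dvd_ne_zero ht r.2
  have hrt : (r.1 : ℤ) ∣ t := by exact_mod_cast r.2
  obtain ⟨c, d, hcd, rfl⟩ := m.exists_rep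
  obtain ⟨a, b, h, rfl⟩ := w.exists_rep ht
  have hx := primitive_line hr0 hcd
  have hred : OO.reduce ht r.2 (OO.mk ⟨residue t a b, residue_mem_NN_of_isCoprime t h⟩) =
      OO.mk ⟨residue r.1 a b, residue_mem_NN_of_isCoprime r.1 h⟩ := by
    refine congrArg OO.mk (Subtype.ext ?_)
    simp [residue]
  have hmk : (MM.mk ⟨residue r.1 c d, hcd⟩).toOO = OO.mk ⟨residue r.1 c d, hcd⟩ := rfl
  rw [hred, hmk, lineVertex_mk, planeVertex_mk_of_isCoprime ht h, building_adj_iff_exists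
    (by rw [line_val]; exact finrank_span_singleton (toRat_ne_zero hx.ne_zero))
    (finrank_plane t (pair_ne_zero_of_isCoprime h))]
  simp only [line_val, act_span_singleton, Submodule.span_singleton_le_iff_mem]
  constructor
  · rintro ⟨g, hg, hmem⟩
    obtain ⟨m, n, hmn⟩ := exists_of_toRat_mem_plane h hmem
    have := VecEquiv.dvd ht ⟨g, hg, hmn⟩ hrt (by simp) (by simp)
    refine (OO.mk_eq_mk_of_residue (c := n) hr0 rfl (residue_eq_iff.2 ?_)).symm
    simpa using ⟨this.2.1, this.2.2.2⟩
  · intro he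
    obtain ⟨u, hu⟩ := OO.mk_eq_mk.1 he.symm
    obtain ⟨n, hn⟩ := ZMod.intCast_surjective (u : ZMod r.1)
    have hnu : IsCoprime (r.1 : ℤ) n :=
      (ZMod.coe_int_isUnit_iff_isCoprime n r.1).1 (hn ▸ Units.isUnit _)
    change (u : ZMod r.1) • residue r.1 a b = residue r.1 c d at hu
    rw [← hn, smul_residue, residue_eq_iff] at hu
    obtain ⟨α, β, hαβ⟩ := h
    obtain ⟨k, l, hkl⟩ := hnu
    -- The vector `(r, n a, 0, n b)` of the plane is primitive and has the invariants of the line.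
    have hy : Primitive ![(r.1 : ℤ), n * a, 0, n * b] := by
      apply primitive_of_dotProduct (y := ![k, l * α, 0, l * β])
      simp [dotProduct, Fin.sum_univ_four]
      linear_combination hkl + l * n * hαβ
    obtain ⟨g, hg, hgx⟩ := (vecEquiv_normalForm (t := t) (r := r.1) (a := c) (b := d) hy
      (by simp [Nat.gcd_eq_right r.2]) (by simpa using (dvd_sub_comm.1 hu.1))
      (by simpa using (dvd_sub_comm.1 hu.2))).symm
    exact ⟨g, hg, by rw [hgx]; exact toRat_mem_plane t a b _ n⟩

/-! ### Numbers of vertices -/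

/-- The pairs of elements of a ring with zero annihilator; `𝒩(n)` is the case of `ℤ/n`. -/
def faithfulPairs (R : Type*) [CommRing R] : Set (R × R) := {p | ∀ c : R, c ≠ 0 → c • p ≠ 0}

theorem card_faithfulPairs_congr {R S : Type*} [CommRing R] [CommRing S] (e : R ≃+* S) :
    Nat.card (faithfulPairs R) = Nat.card (faithfulPairs S) := by
  refine Nat.card_congr ((Equiv.prodCongr e.toEquiv e.toEquiv).subtypeEquiv ?_)
  rintro ⟨a, b⟩
  simp only [faithfulPairs, Set.mem_ofPred_eq, Ne, Prod.smul_mk, Prod.mk_eq_zero, smul_eq_mul,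
    Equiv.prodCongr_apply, Prod.map_apply, RingEquiv.toEquiv_eq_coe, EquivLike.coe_coe]
  rw [← e.toEquiv.forall_congr_right]
  simp [← map_mul]

theorem card_faithfulPairs_prod (R S : Type*) [CommRing R] [CommRing S] :
    Nat.card (faithfulPairs (R × S)) = Nat.card (faithfulPairs R) * Nat.card (faithfulPairs S) := by
  rw [← Nat.card_prod]
  refine Nat.card_congr (((Equiv.prodProdProdComm R S R S).subtypeEquiv ?_).trans
    (Equiv.Set.prod (faithfulPairs R) (faithfulPairs S)))
  rintro ⟨⟨a, b⟩, ⟨c, d⟩⟩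
  simp only [faithfulPairs, Set.mem_ofPred_eq, Ne, Prod.smul_mk, Prod.mk_eq_zero, smul_eq_mul,
    Equiv.prodProdProdComm_apply, Set.mem_prod, Prod.forall, Prod.mk_mul_mk]
  constructor
  · intro h
    refine ⟨fun x hx hxa => h x 0 (fun h => hx h.1) ?_, fun x hx hxa => h 0 x (fun h => hx h.2) ?_⟩
    · simp [hxa.1, hxa.2]
    · simp [hxa.1, hxa.2]
  · rintro ⟨h1, h2⟩ x y hxy h
    exact hxy ⟨by_contra fun hx => h1 x hx ⟨h.1.1, h.2.1⟩,
      by_contra fun hy => h2 y hy ⟨h.1.2, h.2.2⟩⟩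

theorem card_faithfulPairs_field (K : Type*) [Field K] [Finite K] :
    Nat.card (faithfulPairs K) = Nat.card K ^ 2 - 1 := by
  have h : faithfulPairs K = {0}ᶜ := by
    ext p
    simp only [faithfulPairs, Set.mem_ofPred_eq, Set.mem_compl_iff, Set.mem_singleton_iff]
    constructor
    · rintro h rfl
      exact h 1 one_ne_zero (smul_zero _)
    · exact fun hp c hc => smul_ne_zero hc hp
  rw [h, Nat.card_coe_set_eq, Set.ncard_compl, Set.ncard_singleton, Nat.card_prod, sq]

/-- Multiplicativity of `|𝒩(n)|` comes from the Chinese remainder theorem, so for squarefree `n`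
only the case of a field remains. -/
theorem card_NN {n : ℕ} (hn : Squarefree n) :
    (Nat.card (NN n) : ℚ) = (n : ℚ) ^ 2 * ∏ q ∈ n.primeFactors, (1 - 1 / (q : ℚ) ^ 2) := by
  change (Nat.card (faithfulPairs (ZMod n)) : ℚ) = _
  induction n using induction_on_primes with
  | zero => exact absurd rfl hn.ne_zero
  | one =>
    have : faithfulPairs (ZMod 1) = Set.univ :=
      Set.eq_univ_of_forall fun p c hc => (hc (Subsingleton.elim _ _)).elim
    rw [this]
    simp
  | prime_mul p m hp ih =>
    have hcop : Nat.Coprime p m := Nat.coprime_of_squarefree_mul hn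
    have hpm : p ∉ m.primeFactors := fun h =>
      (hp.coprime_iff_not_dvd.1 hcop) (Nat.dvd_of_mem_primeFactors h)
    have := Fact.mk hp
    have hp0 : (p : ℚ) ≠ 0 := by exact_mod_cast hp.ne_zero
    have h1 : 1 ≤ p ^ 2 := Nat.one_le_pow _ _ hp.pos
    rw [card_faithfulPairs_congr (ZMod.chineseRemainder hcop), card_faithfulPairs_prod,
      card_faithfulPairs_field, Nat.cast_mul, ih (hn.of_mul_right),
      hcop.primeFactors_mul, hp.primeFactors, Finset.prod_union (by simpa using hpm),
      Finset.prod_singleton, Nat.card_zmod, Nat.cast_sub h1]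
    push_cast
    field_simp

theorem card_eq_mul_of_card_fiber {A B : Type*} [Finite A] [Finite B] (f : A → B) (k : ℕ)
    (h : ∀ b, Nat.card {a // f a = b} = k) : Nat.card A = k * Nat.card B := by
  have := Fintype.ofFinite B
  rw [← Nat.card_congr (Equiv.sigmaFiberEquiv f), Nat.card_sigma]
  simp [h, mul_comm]

theorem finite_NN {n : ℕ} (hn : n ≠ 0) : Finite (NN n) := by
  have := NeZero.mk hn
  infer_instance

theorem finite_MM {n : ℕ} (hn : n ≠ 0) : Finite (MM n) := by
  have := finite_NN hn
  exact Finite.of_surjective (MM.mk (n := n)) Quotient.mk_surjective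

theorem finite_OO {n : ℕ} (hn : n ≠ 0) : Finite (OO n) := by
  have := finite_NN hn
  exact Finite.of_surjective (OO.mk (n := n)) Quotient.mk_surjective

theorem unit_smul_mem_NN {n : ℕ} (u : (ZMod n)ˣ) {p : ZMod n × ZMod n} (hp : p ∈ NN n) :
    (u : ZMod n) • p ∈ NN n := by
  intro c hc h
  rw [smul_smul] at h
  exact hp _ (fun h0 => hc ((Units.mul_left_eq_zero u).1 h0)) h

theorem card_NN_eq_totient_mul {n : ℕ} (hn : n ≠ 0) :
    Nat.card (NN n) = n.totient * Nat.card (OO n) := by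
  have := finite_NN hn
  have := finite_OO hn
  have := NeZero.mk hn
  refine card_eq_mul_of_card_fiber OO.mk _ fun w => ?_
  obtain ⟨p, rfl⟩ := Quotient.mk_surjective w
  -- The units act freely on `𝒩(n)`.
  rw [← ZMod.card_units_eq_totient, ← Nat.card_eq_fintype_card]
  symm
  refine Nat.card_congr (Equiv.ofBijective
    (fun u : (ZMod n)ˣ => ⟨⟨(u : ZMod n) • p.1, unit_smul_mem_NN u p.2⟩,
      (OO.mk_eq_mk.2 ⟨u, rfl⟩).symm⟩) ⟨?_, ?_⟩)
  · intro u v huv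
    have h : (u : ZMod n) • p.1 = (v : ZMod n) • p.1 :=
      congrArg (fun x => x.1.1) huv
    ext
    by_contra hne
    exact p.2 _ (sub_ne_zero.2 hne) (by rw [sub_smul, h, sub_self])
  · rintro ⟨q, hq⟩
    obtain ⟨u, hu⟩ := OO.mk_eq_mk.1 (show OO.mk p = OO.mk q from hq.symm)
    exact ⟨u, Subtype.ext (Subtype.ext hu)⟩

theorem card_OO {n : ℕ} (hn : Squarefree n) : (Nat.card (OO n) : ℚ) = nuTilde n := by
  have h := card_NN hn
  rw [card_NN_eq_totient_mul hn.ne_zero] at h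
  push_cast at h
  unfold nuTilde
  split_ifs with h1 h2
  · subst h1
    simpa using h
  · subst h2
    rw [Nat.prime_two.primeFactors] at h
    norm_num at h
    exact h
  · have h0 : (n.totient : ℚ) ≠ 0 := by
      exact_mod_cast (Nat.totient_pos.2 (Nat.pos_of_ne_zero hn.ne_zero)).ne'
    rw [mul_assoc, ← h, one_div, inv_mul_cancel_left₀ h0]

theorem neg_mem_NN {n : ℕ} {p : ZMod n × ZMod n} (hp : p ∈ NN n) : -p ∈ NN n := by
  intro c hc h
  exact hp c hc (by rwa [smul_neg, neg_eq_zero] at h)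

theorem card_NN_eq_card_MM {n : ℕ} (hn2 : n ∣ 2) :
    Nat.card (NN n) = Nat.card (MM n) := by
  refine Nat.card_congr (Equiv.ofBijective MM.mk ⟨?_, Quotient.mk_surjective⟩)
  intro p q h
  have h2 : (2 : ZMod n) = 0 := by exact_mod_cast (ZMod.natCast_eq_zero_iff 2 n).2 hn2
  have hneg : ∀ x : ZMod n, -x = x := fun x => by linear_combination (-x) * h2
  have hneg' : ∀ x : ZMod n × ZMod n, -x = x := fun x => Prod.ext (hneg _) (hneg _)
  rcases MM.mk_eq_mk.1 h with h | h
  · exact Subtype.ext h.symm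
  · exact Subtype.ext (h.trans (hneg' _)).symm

theorem card_NN_eq_two_mul {n : ℕ} (hn : n ≠ 0) (hn2 : ¬ n ∣ 2) :
    Nat.card (NN n) = 2 * Nat.card (MM n) := by
  have := finite_NN hn
  have := finite_MM hn
  refine card_eq_mul_of_card_fiber MM.mk _ fun w => ?_
  obtain ⟨p, rfl⟩ := Quotient.mk_surjective w
  let p' : NN n := ⟨-p.1, neg_mem_NN p.2⟩
  have hne : p ≠ p' := by
    intro h
    have h' : p.1 = -p.1 := congrArg Subtype.val h
    have h2 : (2 : ZMod n) ≠ 0 := by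
      intro h
      exact hn2 ((ZMod.natCast_eq_zero_iff 2 n).1 (by exact_mod_cast h))
    refine p.2 2 h2 ?_
    rw [two_smul]
    nth_rewrite 1 [h']
    exact neg_add_cancel _
  have hset : {q : NN n | MM.mk q = MM.mk p} = {p, p'} := by
    ext q
    rw [Set.mem_ofPred_eq, eq_comm, MM.mk_eq_mk]
    simp only [Set.mem_insert_iff, Set.mem_singleton_iff, Subtype.ext_iff, p']
  change Nat.card {q : NN n | MM.mk q = MM.mk p} = 2
  rw [hset, Nat.card_coe_set_eq, Set.ncard_pair hne]

theorem card_MM {n : ℕ} (hn : Squarefree n) : (Nat.card (MM n) : ℚ) = nu n := by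
  have h := card_NN hn
  unfold nu
  split_ifs with h1 h2
  · subst h1
    rw [card_NN_eq_card_MM (by norm_num)] at h
    simpa using h
  · subst h2
    rw [card_NN_eq_card_MM dvd_rfl, Nat.prime_two.primeFactors] at h
    norm_num at h
    exact h
  · have hn2 : ¬ n ∣ 2 := fun h => ((Nat.dvd_prime Nat.prime_two).1 h).elim h1 h2
    rw [card_NN_eq_two_mul hn.ne_zero hn2] at h
    push_cast at h
    linear_combination h / 2

theorem card_lineVertices {t : ℕ} (ht : Squarefree t) :
    (Nat.card {x : Vertex t // IsLineVertex x} : ℚ) = psi t := by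
  have hs : ∀ r : {r : ℕ // r ∣ t}, Finite (MM r.1) := fun r =>
    finite_MM (ne_zero_of_dvd_ne_zero ht.ne_zero r.2)
  have hmem : ∀ r, r ∣ t ↔ r ∈ t.divisors := fun r => by simp [ht.ne_zero]
  have : Fintype {r : ℕ // r ∣ t} := Fintype.subtype t.divisors fun r => (hmem r).symm
  have h1 : Nat.card {x : Vertex t // IsLineVertex x} =
      Nat.card (Σ r : {r : ℕ // r ∣ t}, MM r.1) := by
    rw [Nat.card_congr (Equiv.ofInjective _ (lineVertex_injective ht.ne_zero)),
      range_lineVertex]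
    rfl
  rw [h1, Nat.card_sigma, psi]
  push_cast
  rw [Finset.sum_subtype t.divisors (fun r => (hmem r).symm)]
  exact Finset.sum_congr rfl fun r _ => card_MM (ht.squarefree_of_dvd r.2)

theorem card_planeVertices {t : ℕ} (ht : Squarefree t) :
    (Nat.card {x : Vertex t // IsPlaneVertex x} : ℚ) = nuTilde t := by
  rw [← card_OO ht, Nat.card_congr (Equiv.ofInjective _ (planeVertex_injective ht.ne_zero)),
    range_planeVertex ht]
  rfl

end ParaTits

theorem mainTheorem4 (t : ℕ) (ht : Squarefree t) :
    -- numbers of line vertices and of plane vertices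
    (Nat.card {x : Vertex t // IsLineVertex x} : ℚ) = psi t ∧
    (Nat.card {x : Vertex t // IsPlaneVertex x} : ℚ) = nuTilde t ∧
    -- the vertices are enumerated, without repetition, by the given representatives
    ∃ ℓ : LineIndex t → Vertex t, ∃ h : OO t → Vertex t,
      (∀ (r : {r : ℕ // r ∣ t ∧ r ≠ 1}) (a b : ℤ) (hab : residue r.1 a b ∈ NN r.1),
        ℓ ⟨r, MM.mk ⟨residue r.1 a b, hab⟩⟩ =
          vertexOf (line t (ne_zero_of_dvd_ne_zero ht.ne_zero r.2.1) a b)) ∧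
      (∀ (a b : ℤ) (hab : residue t a b ∈ NN t), (a, b) ≠ (0, 0) →
        h (OO.mk ⟨residue t a b, hab⟩) = vertexOf (plane t a b)) ∧
      Function.Injective ℓ ∧ vertexOf (line0 t) ∉ Set.range ℓ ∧
      insert (vertexOf (line0 t)) (Set.range ℓ) = {x | IsLineVertex x} ∧
      Function.Injective h ∧ Set.range h = {x | IsPlaneVertex x} ∧
      -- every vertex is either a line vertex or a plane vertex
      (∀ x : Vertex t, Xor (IsLineVertex x) (IsPlaneVertex x)) ∧
      -- the edges
      (∀ w : OO t, (building t).Adj (h w) (vertexOf (line0 t))) ∧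
      (∀ (i : LineIndex t) (w : OO t),
        (building t).Adj (ℓ i) (h w) ↔ i.2.toOO = w.reduce ht.ne_zero i.1.2.1) ∧
      (∀ x y : Vertex t, (building t).Adj x y →
        (IsLineVertex x ∧ IsPlaneVertex y) ∨ (IsPlaneVertex x ∧ IsLineVertex y)) := by 
  have ht0 := ht.ne_zero
  -- The index set of the theorem inside that of `lineVertex`, which also contains `r = 1`.
  set ι : LineIndex t → Σ r : {r : ℕ // r ∣ t}, MM r.1 := fun i => ⟨⟨i.1.1, i.1.2.1⟩, i.2⟩ with hι
  have hιinj : Function.Injective ι := by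
    rintro ⟨⟨r, hr, hr1⟩, m⟩ ⟨⟨r', hr', hr1'⟩, m'⟩ h
    simp only [hι, Sigma.mk.injEq, Subtype.mk.injEq] at h
    obtain ⟨rfl, h⟩ := h
    rw [eq_of_heq h]
  have hmem1 : (0 : ZMod 1 × ZMod 1) ∈ NN 1 := fun c hc => (hc (Subsingleton.elim _ _)).elim
  have h0 := vertexOf_line0 ht0 (MM.mk ⟨0, hmem1⟩)
  refine ⟨card_lineVertices ht, card_planeVertices ht, fun i => lineVertex ht0 (ι i),
    planeVertex ht0, fun r a b hab => lineVertex_mk ht0 ⟨r.1, r.2.1⟩ a b hab,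
    planeVertex_mk ht0, (lineVertex_injective ht0).comp hιinj, ?_, ?_, planeVertex_injective ht0,
    range_planeVertex ht, xor_isLineVertex_isPlaneVertex ht0, adj_planeVertex_line0 ht0,
    fun i w => adj_lineVertex_planeVertex_iff ht0 (ι i) w,
    fun x y h => isLineVertex_and_isPlaneVertex_of_adj ht0 h⟩
  · rintro ⟨i, hi⟩
    have := lineVertex_injective ht0 (hi.trans h0.symm)
    exact i.1.2.2 (congrArg (fun j => j.1.1) this)
  · rw [← range_lineVertex ht0]
    apply Set.Subset.antisymm
    · rintro _ (rfl | ⟨i, rfl⟩)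
      · exact ⟨_, h0⟩
      · exact ⟨_, rfl⟩
    · rintro _ ⟨⟨⟨r, hr⟩, m⟩, rfl⟩
      by_cases hr1 : r = 1
      · subst hr1
        exact Or.inl (vertexOf_line0 ht0 m)
      · exact Or.inr ⟨⟨⟨r, hr, hr1⟩, m⟩, rfl⟩
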